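/- **Theorem (ordering based on $S_{Ti}$ works for orthogonal true and irrelevant regressors).** Consider the linear regression $y_t=\sum_{i=1}^p\beta_{i}x_{i,t}+\varepsilon_t$, where $\varepsilon_t$ are i.i.d. $N(0,\sigma^2)$, $\sigma^2>0$, and $w_t=(y_t,x_{1,t},\dots,x_{p,t},\varepsilon_t)'$ is a mean-zero stationary linear process, i.e. $w_t=\sum_{s\in\mathbb Z}C_s\eta_{t-s}$ in mean square, with i.i.d. mean-zero square-integrable innovation vectors $\eta_t$ and square-summable coefficient matrices $C_s$. Let $\Sigma_{ij}=E(x_{i,t}x_{j,t})$, assume that $\Sigma_{xx}=(\Sigma_{ij})_{i,j\le p}$ is positive definite and $E(x_{i,t}\varepsilon_t)=0$ for all $i$. Let $\mathbb T=\{i:\beta_i\ne0\}$ be the set of true regressors, $r_0=|\mathbb T|$, and let $\mathbb M=\{1,\dots,p\}\setminus\mathbb T$ be the set of irrelevant ones; assume $r_0\ge1$. Given the sample $(y,X)$, $t=1,\dots,n$, and $\gamma\in\Gamma=\{0,1\}^p$, let $D_\gamma=\mathrm{diag}(\gamma)$, $\widehat\beta_\gamma=(D_\gamma X'XD_\gamma)^+D_\gamma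 X'y$ (with $A^+$ the Moore–Penrose inverse), $\widehat\sigma^2_\gamma=n^{-1}\|y-X\widehat\beta_\gamma\|^2$, $k_\gamma=\sum_i\gamma_i$, and $q(\gamma)=\mathrm{BIC}(\gamma)=\log\widehat\sigma^2_\gamma+k_\gamma\log(n)/n$. With $\gamma$ uniformly distributed on $\Gamma$ (conditionally on the sample), $\gamma_{-i}$ denoting $\gamma$ without its $i$-th coordinate, and $\mathbb E,\mathbb V$ the expectation and variance in $\gamma$, put $V=\mathbb V(q)$, $\sigma_{Ti}^2=\mathbb E_{\gamma_{-i}}(\mathbb V_{\gamma_i}(q\mid\gamma_{-i}))$ and $S_{Ti}=\sigma_{Ti}^2/V$. Let $S_{T(1)}\ge\dots\ge S_{T(p)}$ be the values $S_{T1},\dots,S_{Tp}$ in decreasing order. Assume $\Sigma_{\ell j}=0$ for all $j\in\mathbb T$ and $\ell\in\mathbb M$. Then there are constants $V_\infty>0$ and $c_1,\dots,c_p$, with $c_i>0$ for $i\in\mathbb T$ and $c_i=0$ for $i\in\mathbb M$, such that, as $n\to\infty$, $\sigma^2_{Ti}\overset{p}{\to}c_i$ for every $i$, $V\overset{p}{\to}V_\infty$,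 and $$(S_{T(1)},\dots,S_{T(p)})\overset{p}{\to}\bigl(c_{(1)}/V_\infty,\dots,c_{(r_0)}/V_\infty,0,\dots,0\bigr),$$ where $c_{(1)}\ge\dots\ge c_{(r_0)}>0$ are the values $c_i$, $i\in\mathbb T$, in decreasing order. Hence, with probability tending to one, every arrangement of the regressors in decreasing order of $S_{Ti}$ places the $r_0$ true regressors in the first $r_0$ positions and the irrelevant ones in the last $p-r_0$ positions. -/

import Mathlib

open MeasureTheory ProbabilityTheory Filter Topology Matrix
open scoped NNReal ENNReal BigOperators

noncomputable section

namespace GSA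

/-! ### Moore–Penrose inverse -/

/-- The four Penrose equations: `B` is the Moore–Penrose inverse of the real matrix `A`. -/
structure IsMoorePenrose {m n : Type*} [Fintype m] [Fintype n]
    (A : Matrix m n ℝ) (B : Matrix n m ℝ) : Prop where
  mul_mul_left : A * B * A = A
  mul_mul_right : B * A * B = B
  symm_left : (A * B)ᵀ = A * B
  symm_right : (B * A)ᵀ = B * A

theorem IsMoorePenrose.unique {m n : Type*} [Fintype m] [Fintype n]
    {A : Matrix m n ℝ} {B C : Matrix n m ℝ}
    (hB : IsMoorePenrose A B) (hC : IsMoorePenrose A C) : B = C := by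
  have h1 : A * B = A * C := by
    calc A * B = (A * B)ᵀ := hB.symm_left.symm
      _ = ((A * C) * (A * B))ᵀ := by
          rw [← Matrix.mul_assoc, hC.mul_mul_left]
      _ = (A * B)ᵀ * (A * C)ᵀ := Matrix.transpose_mul _ _
      _ = A * B * A * C := by
          rw [hB.symm_left, hC.symm_left, ← Matrix.mul_assoc]
      _ = A * C := by rw [hB.mul_mul_left]
  have h2 : B * A = C * A := by
    calc B * A = (B * A)ᵀ := hB.symm_right.symm
      _ = ((B * A) * (C * A))ᵀ := by
          rw [Matrix.mul_assoc B, ← Matrix.mul_assoc A, hC.mul_mul_left]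
      _ = (C * A)ᵀ * (B * A)ᵀ := Matrix.transpose_mul _ _
      _ = C * (A * B * A) := by
          rw [hB.symm_right, hC.symm_right]; simp only [Matrix.mul_assoc]
      _ = C * A := by rw [hB.mul_mul_left]
  calc B = B * A * B := hB.mul_mul_right.symm
    _ = C * A * B := by rw [h2]
    _ = C * (A * C) := by rw [Matrix.mul_assoc, h1]
    _ = C := by rw [← Matrix.mul_assoc, hC.mul_mul_right]

theorem exists_isMoorePenrose_of_symm {n : Type*} [Fintype n] [DecidableEq n]
    (S : Matrix n n ℝ) (hS : S.IsHermitian) :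
    ∃ B : Matrix n n ℝ, Bᵀ = B ∧ IsMoorePenrose S B := by
  set U : Matrix n n ℝ := (hS.eigenvectorUnitary : Matrix n n ℝ) with hU
  set d : n → ℝ := hS.eigenvalues with hd
  have hUU : star U * U = 1 := Unitary.coe_star_mul_self hS.eigenvectorUnitary
  have hspec : S = U * diagonal d * star U := by
    have h := hS.spectral_theorem
    rw [Unitary.conjStarAlgAut_apply] at h
    exact h
  have hstar : star U = Uᵀ := by
    rw [Matrix.star_eq_conjTranspose, Matrix.conjTranspose_eq_transpose_of_trivial]
  have key : ∀ a b : n → ℝ, (U * diagonal a * star U) * (U * diagonal b * star U)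
      = U * diagonal (fun i => a i * b i) * star U := by
    intro a b
    calc (U * diagonal a * star U) * (U * diagonal b * star U)
        = U * diagonal a * (star U * U) * diagonal b * star U := by
          simp only [Matrix.mul_assoc]
      _ = U * diagonal (fun i => a i * b i) * star U := by
          rw [hUU, Matrix.mul_one, Matrix.mul_assoc U, Matrix.diagonal_mul_diagonal]
  have hsym : ∀ a : n → ℝ, (U * diagonal a * star U)ᵀ = U * diagonal a * star U := by
    intro a
    rw [hstar]
    simp only [Matrix.transpose_mul, Matrix.transpose_transpose, Matrix.diagonal_transpose,
      Matrix.mul_assoc]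
  refine ⟨U * diagonal (fun i => (d i)⁻¹) * star U, hsym _, ?_⟩
  rw [hspec]
  refine ⟨?_, ?_, ?_, ?_⟩
  · rw [key, key]; congr 3; funext i; exact mul_inv_mul_cancel (d i)
  · rw [key, key]; congr 3; funext i; by_cases h : d i = 0 <;> simp [h]
  · rw [key]; exact hsym _
  · rw [key]; exact hsym _

theorem exists_isMoorePenrose {m n : Type*} [Fintype m] [Fintype n]
    (A : Matrix m n ℝ) : ∃ B, IsMoorePenrose A B := by
  classical
  have hS : (Aᵀ * A).IsHermitian := by
    rw [Matrix.IsHermitian, Matrix.conjTranspose_eq_transpose_of_trivial,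
      Matrix.transpose_mul, Matrix.transpose_transpose]
  obtain ⟨P, hPs, hP⟩ := exists_isMoorePenrose_of_symm (Aᵀ * A) hS
  have h0 : A * (P * (Aᵀ * A) - 1) = 0 := by
    rw [← Matrix.conjTranspose_mul_self_eq_zero, Matrix.conjTranspose_eq_transpose_of_trivial,
      Matrix.transpose_mul]
    calc (P * (Aᵀ * A) - 1)ᵀ * Aᵀ * (A * (P * (Aᵀ * A) - 1))
        = (P * (Aᵀ * A) - 1)ᵀ * ((Aᵀ * A) * P * (Aᵀ * A) - Aᵀ * A) := by
          simp only [Matrix.mul_assoc, Matrix.mul_sub, Matrix.mul_one]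
      _ = 0 := by rw [hP.mul_mul_left, sub_self, Matrix.mul_zero]
  have h1 : A * (P * (Aᵀ * A)) = A := by
    rw [Matrix.mul_sub, Matrix.mul_one] at h0
    exact sub_eq_zero.mp h0
  refine ⟨P * Aᵀ, ?_, ?_, ?_, ?_⟩
  · simpa only [Matrix.mul_assoc] using h1
  · have h2 := congrArg (· * Aᵀ) hP.mul_mul_right
    simpa only [Matrix.mul_assoc] using h2
  · simp only [Matrix.transpose_mul, Matrix.transpose_transpose, hPs, Matrix.mul_assoc]
  · simpa only [Matrix.mul_assoc] using hP.symm_right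

/-- The Moore–Penrose inverse `A⁺` of a real matrix. -/
def pinv {m n : Type*} [Fintype m] [Fintype n] (A : Matrix m n ℝ) : Matrix n m ℝ :=
  (exists_isMoorePenrose A).choose

theorem isMoorePenrose_pinv {m n : Type*} [Fintype m] [Fintype n] (A : Matrix m n ℝ) :
    IsMoorePenrose A (pinv A) :=
  (exists_isMoorePenrose A).choose_spec

/-! ### Submodels, least squares and BIC -/

/-- `Γ = {0,1}^p`, the set of submodels. -/
abbrev Model (p : ℕ) : Type := Fin p → Bool

/-- `D_γ = diag(γ)`. -/
def selMatrix {p : ℕ} (γ : Model p) : Matrix (Fin p) (Fin p) ℝ :=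
  diagonal fun i => if γ i then 1 else 0

/-- `k_γ`, the number of regressors in model `γ`. -/
def numReg {p : ℕ} (γ : Model p) : ℕ := (Finset.univ.filter fun i => γ i = true).card

/-- Least squares estimator `β̂_γ = (D_γ X' X D_γ)⁺ D_γ X' y` of model `γ`. -/
def olsEstimator {n p : ℕ} (X : Matrix (Fin n) (Fin p) ℝ) (y : Fin n → ℝ) (γ : Model p) :
    Fin p → ℝ :=
  (pinv (selMatrix γ * Xᵀ * X * selMatrix γ) * selMatrix γ * Xᵀ) *ᵥ y

/-- Least squares residuals of model `γ`. -/
def residual {n p : ℕ} (X : Matrix (Fin n) (Fin p) ℝ) (y : Fin n → ℝ) (γ : Model p) :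
    Fin n → ℝ :=
  y - X *ᵥ olsEstimator X y γ

/-- `σ̂²_γ = n⁻¹ ε̂_γ' ε̂_γ`. -/
def sigmaHatSq {n p : ℕ} (X : Matrix (Fin n) (Fin p) ℝ) (y : Fin n → ℝ) (γ : Model p) : ℝ :=
  (n : ℝ)⁻¹ * (residual X y γ ⬝ᵥ residual X y γ)

/-- `BIC(γ) = log σ̂²_γ + k_γ log(n)/n`. -/
def bic {n p : ℕ} (X : Matrix (Fin n) (Fin p) ℝ) (y : Fin n → ℝ) (γ : Model p) : ℝ :=
  Real.log (sigmaHatSq X y γ) + numReg γ * (Real.log n / n)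

/-! ### Total sensitivity indices

`Finset.expect`, written `𝔼 a, f a`, is the average of `f` over a finite type, i.e. the expectation
under the uniform distribution. -/

/-- Variance of `f` under the uniform distribution on a finite type. -/
def unifVar {α : Type*} [Fintype α] (f : α → ℝ) : ℝ := 𝔼 a, (f a - 𝔼 b, f b) ^ 2

/-- The model `γ` with `i`-th coordinate `γ_i = b` and remaining coordinates `γ_{-i} = g`. -/
def combine {p : ℕ} (i : Fin p) (b : Bool) (g : {j : Fin p // j ≠ i} → Bool) : Model p :=
  fun j => if h : j = i then b else g ⟨j, h⟩

/-- `σ²_{Ti} = E_{γ_{-i}} (V_{γ_i} (q ∣ γ_{-i}))`. -/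
def totalEffectVar {p : ℕ} (q : Model p → ℝ) (i : Fin p) : ℝ :=
  𝔼 g : {j : Fin p // j ≠ i} → Bool, unifVar fun b : Bool => q (combine i b g)

/-- The total sensitivity index `S_{Ti} = σ²_{Ti} / V`, `V = V(q)`. -/
def totalSensitivity {p : ℕ} (q : Model p → ℝ) (i : Fin p) : ℝ :=
  totalEffectVar q i / unifVar q

/-- The decreasing rearrangement `(a_{(1)} ≥ a_{(2)} ≥ … ≥ a_{(p)})` of a vector
(positions counted from `0`). -/
def decreasing {p : ℕ} (a : Fin p → ℝ) : Fin p → ℝ := fun k => a (Tuple.sort a (Fin.rev k))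

theorem antitone_decreasing {p : ℕ} (a : Fin p → ℝ) : Antitone (decreasing a) :=
  fun _ _ h => Tuple.monotone_sort a (Fin.rev_le_rev.mpr h)

/-! ### The regression model -/

/-- `w` is a (vector) stationary linear process `w_t = ∑_{s ∈ ℤ} C_s η_{t-s}`: the innovations `η`
are i.i.d. random vectors with mean zero and finite second moments, the coefficients are square
summable, and the series converges in mean square. -/
def IsLinearProcess {Ω : Type*} [MeasurableSpace Ω] (P : Measure Ω) {κ : Type*}
    (w : ℤ → Ω → κ → ℝ) : Prop :=
  ∃ (d : ℕ) (η : ℤ → Ω → EuclideanSpace ℝ (Fin d)) (C : ℤ → Matrix κ (Fin d) ℝ),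
    iIndepFun η P ∧ (∀ t, IdentDistrib (η t) (η 0) P P) ∧
    MemLp (η 0) 2 P ∧ ∫ ω, η 0 ω ∂P = 0 ∧
    (∀ k l, Summable fun s => (C s k l) ^ 2) ∧
    ∀ t k, MemLp (fun ω => w t ω k) 2 P ∧
      Tendsto (fun N : ℕ => eLpNorm
        (fun ω => w t ω k - ∑ s ∈ Finset.Icc (-(N : ℤ)) N, ∑ l, C s k l * η (t - s) ω l) 2 P)
        atTop (𝓝 0)

/-- `Σ_xx = E(x_t x_t')`, the second moment matrix of the regressors (it does not depend on `t` for
a stationary process; we take `t = 1`). -/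
def regressorCov {Ω : Type*} [MeasurableSpace Ω] (P : Measure Ω) {p : ℕ}
    (x : ℤ → Ω → Fin p → ℝ) : Matrix (Fin p) (Fin p) ℝ :=
  Matrix.of fun i j => ∫ ω, x 1 ω i * x 1 ω j ∂P

/-- The linear regression model `y_t = ∑ i, β_i x_{i,t} + ε_t` with i.i.d. `N(0, σ²)` errors,
`σ² > 0`, where `w_t = (x_t, y_t, ε_t)` is a stationary linear process, the errors
are uncorrelated with the regressors and `Σ_xx` is nonsingular. -/
structure IsRegressionModel {Ω : Type*} [MeasurableSpace Ω] (P : Measure Ω) {p : ℕ}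
    (β : Fin p → ℝ) (σsq : ℝ≥0) (x : ℤ → Ω → Fin p → ℝ) (y ε : ℤ → Ω → ℝ) : Prop where
  equation : ∀ t ω, y t ω = ∑ i, β i * x t ω i + ε t ω
  sigma_pos : 0 < σsq
  errors_indep : iIndepFun ε P
  errors_law : ∀ t, HasLaw (ε t) (gaussianReal 0 σsq) P
  linear : IsLinearProcess P
    fun t ω => (Sum.elim (x t ω) ![y t ω, ε t ω] : Fin p ⊕ Fin 2 → ℝ)
  uncorrelated : ∀ i, ∫ ω, x 1 ω i * ε 1 ω ∂P = 0
  nonsingular : (regressorCov P x).PosDef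

/-- The `n × p` matrix of observations `t = 1, …, n` of the regressors. -/
def sampleX {Ω : Type*} {p : ℕ} (x : ℤ → Ω → Fin p → ℝ) (n : ℕ) (ω : Ω) :
    Matrix (Fin n) (Fin p) ℝ :=
  Matrix.of fun t i => x ((t : ℕ) + 1 : ℤ) ω i

/-- The vector of observations `t = 1, …, n` of the dependent variable. -/
def sampleY {Ω : Type*} (y : ℤ → Ω → ℝ) (n : ℕ) (ω : Ω) : Fin n → ℝ :=
  fun t => y ((t : ℕ) + 1 : ℤ) ω

/-- `q = BIC` on the sample of size `n`, as a function of the model `γ`. -/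
def sampleBIC {Ω : Type*} {p : ℕ} (x : ℤ → Ω → Fin p → ℝ) (y : ℤ → Ω → ℝ) (n : ℕ) (ω : Ω) :
    Model p → ℝ :=
  bic (sampleX x n ω) (sampleY y n ω)

/-- `𝕋`, the set of indices of the true regressors. -/
def trueSet {p : ℕ} (β : Fin p → ℝ) : Finset (Fin p) := Finset.univ.filter fun i => β i ≠ 0

end GSA

end

namespace GSA

variable {Ω : Type*} [MeasurableSpace Ω] {P : Measure Ω}

/-! ### A weak law of large numbers for products of linear processes -/

/-! On finitely many models, `q` is a vector with `2^p` coordinates, and all the sensitivity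
quantities are continuous functions of it as long as the total variance is nonzero. So it suffices
to find the probability limit of BIC and evaluate these functions there. The penalty vanishes. Near
a positive definite second moment matrix, the residual variance is a continuous function of the
sample moments (`sigmaHatSq_eq_projRisk`), so the limit of `q γ` is the logarithm of `limitRisk`,
which equals σ² plus the quadratic form of `Σ_xx` at β minus its projection coefficients
(`limitRisk_eq`).

Orthogonality makes that projection depend only on the true regressors in the model, so the limit of
`q` is constant in each irrelevant coordinate and the total effect there is zero. Omitting a true
regressor from the full model raises the risk strictly above σ² (`lt_limitRisk`), so its total
effect and the total variance are positive. Sorting is 1-Lipschitz in the sup norm, which gives the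
ordered limit, and the gap between zero and the smallest true index gives the ranking.

The sample moments need a law of large numbers using second moments only
(`IsLinearProcess.meanErgodic_mul`). It is proved in `L¹`: products of truncated filters are finite
sums of products of two innovations, and `MeanErgodic.of_approx` removes the truncation. -/

/-- The process `u` has constant mean, and its time averages over `t = 1, …, n` converge to this
mean in `L¹`. -/
structure MeanErgodic (P : Measure Ω) (u : ℤ → Ω → ℝ) : Prop where
  integrable : ∀ t, Integrable (u t) P
  integral_eq : ∀ t, ∫ ω, u t ω ∂P = ∫ ω, u 1 ω ∂P
  tendsto : Tendsto (fun n : ℕ => ∫ ω, |(n : ℝ)⁻¹ * ∑ j ∈ Finset.range n, u ((j : ℤ) + 1) ω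
    - ∫ ω', u 1 ω' ∂P| ∂P) atTop (𝓝 0)

theorem integrable_average {u : ℤ → Ω → ℝ} (hu : ∀ t, Integrable (u t) P) (n : ℕ) :
    Integrable (fun ω => (n : ℝ)⁻¹ * ∑ j ∈ Finset.range n, u ((j : ℤ) + 1) ω) P :=
  (integrable_finsetSum _ fun _ _ => hu _).const_mul _

theorem MeanErgodic.integrable_abs [IsFiniteMeasure P] {u : ℤ → Ω → ℝ} (hu : MeanErgodic P u)
    (n : ℕ) :
    Integrable (fun ω => |(n : ℝ)⁻¹ * ∑ j ∈ Finset.range n, u ((j : ℤ) + 1) ω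
      - ∫ ω', u 1 ω' ∂P|) P :=
  ((integrable_average hu.integrable n).sub (integrable_const _)).abs

theorem MeanErgodic.zero : MeanErgodic P (fun _ _ => 0) :=
  ⟨fun _ => integrable_zero _ _ _, by simp, by simp⟩

theorem MeanErgodic.add [IsFiniteMeasure P] {u v : ℤ → Ω → ℝ} (hu : MeanErgodic P u)
    (hv : MeanErgodic P v) : MeanErgodic P (fun t ω => u t ω + v t ω) := by
  refine ⟨fun t => (hu.integrable t).add (hv.integrable t), fun t => ?_, ?_⟩
  · rw [integral_add (hu.integrable t) (hv.integrable t),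
      integral_add (hu.integrable 1) (hv.integrable 1), hu.integral_eq t, hv.integral_eq t]
  · rw [integral_add (hu.integrable 1) (hv.integrable 1)]
    refine squeeze_zero (fun n => integral_nonneg fun ω => abs_nonneg _) (fun n => ?_)
      (by simpa using hu.tendsto.add hv.tendsto)
    rw [← integral_add (hu.integrable_abs n) (hv.integrable_abs n)]
    refine integral_mono_of_nonneg (ae_of_all _ fun ω => abs_nonneg _)
      ((hu.integrable_abs n).add (hv.integrable_abs n)) (ae_of_all _ fun ω => ?_)
    refine le_trans (le_of_eq ?_) (abs_add_le _ _)
    simp only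
    rw [Finset.sum_add_distrib]
    ring_nf

theorem MeanErgodic.const_mul {u : ℤ → Ω → ℝ} (hu : MeanErgodic P u)
    (c : ℝ) : MeanErgodic P (fun t ω => c * u t ω) := by
  refine ⟨fun t => (hu.integrable t).const_mul c, fun t => ?_, ?_⟩
  · rw [integral_const_mul, integral_const_mul, hu.integral_eq t]
  · have h := hu.tendsto.const_mul |c|
    rw [mul_zero] at h
    refine h.congr fun n => ?_
    rw [← integral_const_mul]
    refine integral_congr_ae (ae_of_all _ fun ω => ?_)
    simp only
    rw [← abs_mul, integral_const_mul, ← Finset.mul_sum]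
    ring_nf

theorem MeanErgodic.sum [IsFiniteMeasure P] {ι : Type*} (s : Finset ι) {u : ι → ℤ → Ω → ℝ}
    (hu : ∀ i ∈ s, MeanErgodic P (u i)) : MeanErgodic P (fun t ω => ∑ i ∈ s, u i t ω) := by
  classical
  induction s using Finset.induction_on with
  | empty => simpa using MeanErgodic.zero
  | insert a s ha ih =>
    simp only [Finset.sum_insert ha]
    exact (hu a (by simp)).add (ih fun i hi => hu i (by simp [hi]))

/-- Since the approximation error is uniform in `t`, it bounds the `L¹` distance of the two time
averages for every `n`, and also the distance of the two means. The rest is a three-term triangle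
inequality. -/
theorem MeanErgodic.of_approx [IsProbabilityMeasure P] {u : ℤ → Ω → ℝ}
    (hu : ∀ t, Integrable (u t) P)
    (h : ∀ δ > 0, ∃ v, MeanErgodic P v ∧ ∀ t, ∫ ω, |u t ω - v t ω| ∂P ≤ δ) :
    MeanErgodic P u := by
  have hdiff : ∀ {v : ℤ → Ω → ℝ} {δ : ℝ}, MeanErgodic P v →
      (∀ t, ∫ ω, |u t ω - v t ω| ∂P ≤ δ) → ∀ t, |∫ ω, u t ω ∂P - ∫ ω, v t ω ∂P| ≤ δ := by
    intro v δ hv hvδ t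
    rw [← integral_sub (hu t) (hv.integrable t)]
    exact abs_integral_le_integral_abs.trans (hvδ t)
  refine ⟨hu, fun t => ?_, ?_⟩
  · refine eq_of_abs_sub_le_all fun δ hδ => ?_
    obtain ⟨v, hv, hvδ⟩ := h (δ / 2) (by positivity)
    have h1 := abs_le.1 (hdiff hv hvδ t)
    have h2 := abs_le.1 (hdiff hv hvδ 1)
    rw [hv.integral_eq t] at h1
    exact abs_le.2 ⟨by linarith, by linarith⟩
  · rw [Metric.tendsto_atTop]
    intro δ hδ
    obtain ⟨v, hv, hvδ⟩ := h (δ / 4) (by positivity)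
    obtain ⟨N, hN⟩ := Metric.tendsto_atTop.1 hv.tendsto (δ / 4) (by positivity)
    refine ⟨N, fun n hn => ?_⟩
    have hvn := hN n hn
    rw [Real.dist_eq, sub_zero, abs_of_nonneg (integral_nonneg fun ω => abs_nonneg _)] at hvn ⊢
    have hint : ∀ j : ℕ, Integrable (fun ω => |u ((j : ℤ) + 1) ω - v ((j : ℤ) + 1) ω|) P :=
      fun j => ((hu _).sub (hv.integrable _)).abs
    have hI1 : Integrable (fun ω => (n : ℝ)⁻¹ * ∑ j ∈ Finset.range n,
        |u ((j : ℤ) + 1) ω - v ((j : ℤ) + 1) ω|) P :=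
      (integrable_finsetSum _ fun j _ => hint j).const_mul _
    have hle : ∫ ω, (n : ℝ)⁻¹ * ∑ j ∈ Finset.range n,
        |u ((j : ℤ) + 1) ω - v ((j : ℤ) + 1) ω| ∂P ≤ δ / 4 := by
      rw [integral_const_mul, integral_finsetSum _ fun j _ => hint j]
      calc (n : ℝ)⁻¹ * ∑ j ∈ Finset.range n, ∫ ω, |u ((j : ℤ) + 1) ω - v ((j : ℤ) + 1) ω| ∂P
          ≤ (n : ℝ)⁻¹ * ∑ _j ∈ Finset.range n, δ / 4 := by
            gcongr with j hj
            exact hvδ _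
        _ ≤ δ / 4 := by
            rw [Finset.sum_const, Finset.card_range, nsmul_eq_mul]
            rcases Nat.eq_zero_or_pos n with rfl | hn0
            · simp; positivity
            · rw [inv_mul_cancel_left₀ (by positivity)]
    calc ∫ ω, |(n : ℝ)⁻¹ * ∑ j ∈ Finset.range n, u ((j : ℤ) + 1) ω - ∫ ω', u 1 ω' ∂P| ∂P
        ≤ ∫ ω, ((n : ℝ)⁻¹ * ∑ j ∈ Finset.range n, |u ((j : ℤ) + 1) ω - v ((j : ℤ) + 1) ω|
          + |(n : ℝ)⁻¹ * ∑ j ∈ Finset.range n, v ((j : ℤ) + 1) ω - ∫ ω', v 1 ω' ∂P|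
          + δ / 4) ∂P := by
          refine integral_mono_of_nonneg (ae_of_all _ fun ω => abs_nonneg _)
            ((hI1.add (hv.integrable_abs n)).add (integrable_const _)) (ae_of_all _ fun ω => ?_)
          have e1 : |(n : ℝ)⁻¹ * ∑ j ∈ Finset.range n, u ((j : ℤ) + 1) ω
              - (n : ℝ)⁻¹ * ∑ j ∈ Finset.range n, v ((j : ℤ) + 1) ω|
              ≤ (n : ℝ)⁻¹ * ∑ j ∈ Finset.range n, |u ((j : ℤ) + 1) ω - v ((j : ℤ) + 1) ω| := by
            rw [← mul_sub, ← Finset.sum_sub_distrib, abs_mul,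
              abs_of_nonneg (by positivity : (0 : ℝ) ≤ (n : ℝ)⁻¹)]
            gcongr
            exact Finset.abs_sum_le_sum_abs _ _
          have e2 := hdiff hv hvδ 1
          simp only
          rw [abs_le] at e1 e2 ⊢
          have e3 := neg_abs_le ((n : ℝ)⁻¹ * ∑ j ∈ Finset.range n, v ((j : ℤ) + 1) ω
            - ∫ ω', v 1 ω' ∂P)
          have e4 := le_abs_self ((n : ℝ)⁻¹ * ∑ j ∈ Finset.range n, v ((j : ℤ) + 1) ω
            - ∫ ω', v 1 ω' ∂P)
          constructor <;> linarith [e1.1, e1.2, e2.1, e2.2]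
      _ < δ := by
          rw [integral_add (by exact hI1.add (hv.integrable_abs n)) (integrable_const _),
            integral_add hI1 (hv.integrable_abs n)]
          simp only [integral_const, probReal_univ, one_smul]
          linarith

theorem integral_sum_sq_of_orthogonal {ι : Type*} (s : Finset ι) {X : ι → Ω → ℝ}
    (hX : ∀ i ∈ s, MemLp (X i) 2 P)
    (ho : ∀ i ∈ s, ∀ j ∈ s, i ≠ j → ∫ ω, X i ω * X j ω ∂P = 0) :
    ∫ ω, (∑ i ∈ s, X i ω) ^ 2 ∂P = ∑ i ∈ s, ∫ ω, X i ω ^ 2 ∂P := by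
  have hint : ∀ i ∈ s, ∀ j ∈ s, Integrable (fun ω => X i ω * X j ω) P :=
    fun i hi j hj => (hX i hi).integrable_mul (hX j hj)
  have h1 : ∀ ω, (∑ i ∈ s, X i ω) ^ 2 = ∑ i ∈ s, ∑ j ∈ s, X i ω * X j ω := fun ω => by
    rw [sq, Finset.sum_mul_sum]
  simp_rw [h1]
  rw [integral_finsetSum _ fun i hi => integrable_finsetSum _ fun j hj => hint i hi j hj]
  refine Finset.sum_congr rfl fun i hi => ?_
  rw [integral_finsetSum _ fun j hj => hint i hi j hj,
    Finset.sum_eq_single i (fun j hj hji => ho i hi j hj hji.symm) (fun h => absurd hi h)]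
  simp_rw [sq]

theorem sq_integral_abs_le [IsProbabilityMeasure P] {f : Ω → ℝ} (hf : MemLp f 2 P) :
    (∫ ω, |f ω| ∂P) ^ 2 ≤ ∫ ω, f ω ^ 2 ∂P := by
  have h := variance_nonneg |f| P
  rw [variance_eq_sub hf.abs] at h
  simp only [Pi.pow_apply, Pi.abs_apply, sq_abs] at h
  linarith

/-- Without cross terms, the second moment of the average is at most `K / n`, and the `L¹` norm is
bounded by the `L²` norm. -/
theorem MeanErgodic.of_uncorrelated [IsProbabilityMeasure P] {u : ℤ → Ω → ℝ}
    (hu : ∀ t, MemLp (u t) 2 P) (h0 : ∀ t, ∫ ω, u t ω ∂P = 0)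
    (ho : ∀ s t, s ≠ t → ∫ ω, u s ω * u t ω ∂P = 0)
    {K : ℝ} (hK : ∀ t, ∫ ω, u t ω ^ 2 ∂P ≤ K) : MeanErgodic P u := by
  refine ⟨fun t => (hu t).integrable one_le_two, fun t => by rw [h0, h0], ?_⟩
  have hKn : Tendsto (fun n : ℕ => √(K * (n : ℝ)⁻¹)) atTop (𝓝 0) := by
    have := (tendsto_inv_atTop_zero.comp tendsto_natCast_atTop_atTop).const_mul K
    rw [mul_zero] at this
    have h := (Real.continuous_sqrt.tendsto 0).comp this
    rwa [Real.sqrt_zero] at h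
  refine squeeze_zero (fun n => integral_nonneg fun ω => abs_nonneg _) (fun n => ?_) hKn
  rw [h0]
  simp only [sub_zero]
  refine Real.le_sqrt_of_sq_le ?_
  have hsum : MemLp (fun ω => ∑ j ∈ Finset.range n, u ((j : ℤ) + 1) ω) 2 P :=
    memLp_finsetSum _ fun j _ => hu _
  refine (sq_integral_abs_le (hsum.const_mul _)).trans ?_
  simp_rw [mul_pow]
  rw [integral_const_mul, integral_sum_sq_of_orthogonal _ (fun j _ => hu _)
    (fun i _ j _ hij => ho _ _ (by simpa using hij))]
  calc ((n : ℝ)⁻¹) ^ 2 * ∑ j ∈ Finset.range n, ∫ ω, u ((j : ℤ) + 1) ω ^ 2 ∂P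
      ≤ ((n : ℝ)⁻¹) ^ 2 * ∑ _j ∈ Finset.range n, K := by
        gcongr with j hj
        exact hK _
    _ = K * (n : ℝ)⁻¹ := by
        rw [Finset.sum_const, Finset.card_range, nsmul_eq_mul]
        rcases Nat.eq_zero_or_pos n with rfl | hn0
        · simp
        · field_simp

theorem MeanErgodic.of_iid [IsProbabilityMeasure P] {u : ℤ → Ω → ℝ} (hu : Integrable (u 1) P)
    (hi : Pairwise fun s t => IndepFun (u s) (u t) P)
    (hd : ∀ t, IdentDistrib (u t) (u 1) P P) : MeanErgodic P u := by
  have hint : ∀ t, Integrable (u t) P := fun t => (hd t).integrable_iff.2 hu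
  refine ⟨hint, fun t => (hd t).integral_eq, ?_⟩
  have h := strong_law_Lp (μ := P) le_rfl ENNReal.one_ne_top (fun j : ℕ => u ((j : ℤ) + 1))
    (by simpa using memLp_one_iff_integrable.2 hu)
    (fun i j hij => hi (by simpa using hij))
    (fun i => by simpa using hd ((i : ℤ) + 1))
  have h' := (ENNReal.tendsto_toReal ENNReal.zero_ne_top).comp h
  refine h'.congr fun n => ?_
  simp only [Function.comp_apply]
  rw [eLpNorm_one_eq_lintegral_enorm, ← integral_norm_eq_lintegral_enorm]
  · simp
  · exact ((integrable_average hint n).sub (integrable_const _)).aestronglyMeasurable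

/-! ### Products of two innovations -/

section Innovations

variable {E : Type*} [MeasurableSpace E] {η : ℤ → Ω → E}

/-- The time `a` differs from the other three, which may coincide with each other, so the centred
factor is independent of the rest. The product formula for independent variables needs no
integrability of the rest. -/
theorem integral_mul_mul_mul_eq_zero (hind : iIndepFun η P) (hm : ∀ t, AEMeasurable (η t) P)
    {f g h k : E → ℝ} (hf : Measurable f) (hg : Measurable g) (hh : Measurable h)
    (hk : Measurable k) {a b c d : ℤ} (hab : a ≠ b) (hac : a ≠ c) (had : a ≠ d)
    (h0 : ∫ ω, f (η a ω) ∂P = 0) :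
    ∫ ω, f (η a ω) * (g (η b ω) * (h (η c ω) * k (η d ω))) ∂P = 0 := by
  have hi := hind.indepFun_finset₀ {a} {b, c, d} (by simp [hab, hac, had]) hm
  have hF : Measurable (fun v : ({a} : Finset ℤ) → E => f (v ⟨a, by simp⟩)) :=
    hf.comp (measurable_pi_apply _)
  have hG : Measurable (fun v : ({b, c, d} : Finset ℤ) → E =>
      g (v ⟨b, by simp⟩) * (h (v ⟨c, by simp⟩) * k (v ⟨d, by simp⟩))) :=
    (hg.comp (measurable_pi_apply _)).mul ((hh.comp (measurable_pi_apply _)).mul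
      (hk.comp (measurable_pi_apply _)))
  have := (hi.comp hF hG).integral_fun_mul_eq_mul_integral
    (hf.comp_aemeasurable (hm a)).aestronglyMeasurable
    ((hg.comp_aemeasurable (hm b)).mul ((hh.comp_aemeasurable (hm c)).mul
      (hk.comp_aemeasurable (hm d)))).aestronglyMeasurable
  simp only [Function.comp_apply] at this
  rw [this, h0, zero_mul]

/-- At equal lags the products are i.i.d. but only integrable, so the `L¹` strong law is used. At
different lags the two factors are independent, which makes the product square integrable without
fourth moments, and uncorrelated over time. -/
theorem MeanErgodic.mul_of_iid [IsProbabilityMeasure P] (hind : iIndepFun η P)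
    (hd : ∀ t, IdentDistrib (η t) (η 0) P P) {f g : E → ℝ} (hf : Measurable f)
    (hg : Measurable g) (hf2 : MemLp (fun ω => f (η 0 ω)) 2 P)
    (hg2 : MemLp (fun ω => g (η 0 ω)) 2 P) (hf0 : ∫ ω, f (η 0 ω) ∂P = 0)
    (hg0 : ∫ ω, g (η 0 ω) ∂P = 0) (s s' : ℤ) :
    MeanErgodic P (fun t ω => f (η (t - s) ω) * g (η (t - s') ω)) := by
  have hm : ∀ t, AEMeasurable (η t) P := fun t => (hd t).aemeasurable_fst
  have hdf : ∀ t, IdentDistrib (fun ω => f (η t ω)) (fun ω => f (η 0 ω)) P P :=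
    fun t => (hd t).comp hf
  have hdg : ∀ t, IdentDistrib (fun ω => g (η t ω)) (fun ω => g (η 0 ω)) P P :=
    fun t => (hd t).comp hg
  have hf2' : ∀ t, MemLp (fun ω => f (η t ω)) 2 P := fun t => (hdf t).memLp_iff.2 hf2
  have hg2' : ∀ t, MemLp (fun ω => g (η t ω)) 2 P := fun t => (hdg t).memLp_iff.2 hg2
  have hf0' : ∀ t, ∫ ω, f (η t ω) ∂P = 0 := fun t => (hdf t).integral_eq.trans hf0
  have hg0' : ∀ t, ∫ ω, g (η t ω) ∂P = 0 := fun t => (hdg t).integral_eq.trans hg0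
  by_cases hs : s = s'
  · subst hs
    refine MeanErgodic.of_iid ((hf2' _).integrable_mul (hg2' _)) (fun t t' htt' => ?_) fun t => ?_
    · exact (hind.indepFun (by simpa using htt' : t - s ≠ t' - s)).comp
        (hf.mul hg) (hf.mul hg)
    · exact ((hd (t - s)).trans (hd (1 - s)).symm).comp (hf.mul hg)
  · have hne : ∀ t : ℤ, t - s ≠ t - s' := fun t => by simpa using hs
    have hfg : ∀ t, IndepFun (fun ω => f (η (t - s) ω)) (fun ω => g (η (t - s') ω)) P :=
      fun t => (hind.indepFun (hne t)).comp hf hg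
    have hfgsq : ∀ t, IndepFun (fun ω => f (η (t - s) ω) ^ 2) (fun ω => g (η (t - s') ω) ^ 2) P :=
      fun t => (hind.indepFun (hne t)).comp (hf.pow_const 2) (hg.pow_const 2)
    have hsm : ∀ t, AEStronglyMeasurable (fun ω => f (η (t - s) ω) * g (η (t - s') ω)) P :=
      fun t => (hf2' _).1.mul (hg2' _).1
    refine MeanErgodic.of_uncorrelated (K := (∫ ω, f (η 0 ω) ^ 2 ∂P) * ∫ ω, g (η 0 ω) ^ 2 ∂P)
      (fun t => ?_) (fun t => ?_) (fun t t' htt' => ?_) (fun t => ?_)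
    · rw [memLp_two_iff_integrable_sq (hsm t)]
      simp_rw [mul_pow]
      exact (hfgsq t).integrable_mul (hf2' _).integrable_sq (hg2' _).integrable_sq
    · rw [(hfg t).integral_fun_mul_eq_mul_integral (hf2' _).1 (hg2' _).1, hf0', zero_mul]
    -- In each of the four cases, the latest of the four times occurs exactly once; it plays the
    -- role of `a`.
    · rcases lt_or_gt_of_ne hs with h1 | h1 <;> rcases lt_or_gt_of_ne htt' with h2 | h2
      · rw [← integral_mul_mul_mul_eq_zero hind hm hf hg hf hg (a := t' - s) (b := t' - s')
          (c := t - s) (d := t - s') (by lia) (by lia) (by lia) (hf0' _)]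
        congr 1 with ω; ring
      · rw [← integral_mul_mul_mul_eq_zero hind hm hf hg hf hg (a := t - s) (b := t - s')
          (c := t' - s) (d := t' - s') (by lia) (by lia) (by lia) (hf0' _)]
        congr 1 with ω; ring
      · rw [← integral_mul_mul_mul_eq_zero hind hm hg hf hf hg (a := t' - s') (b := t' - s)
          (c := t - s) (d := t - s') (by lia) (by lia) (by lia) (hg0' _)]
        congr 1 with ω; ring
      · rw [← integral_mul_mul_mul_eq_zero hind hm hg hf hf hg (a := t - s') (b := t - s)
          (c := t' - s) (d := t' - s') (by lia) (by lia) (by lia) (hg0' _)]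
        congr 1 with ω; ring
    · simp_rw [mul_pow]
      rw [(hfgsq t).integral_fun_mul_eq_mul_integral (hf2' _).integrable_sq.1
        (hg2' _).integrable_sq.1]
      have e1 := ((hd (t - s)).comp (hf.pow_const 2)).integral_eq
      have e2 := ((hd (t - s')).comp (hg.pow_const 2)).integral_eq
      simp only [Function.comp_def] at e1 e2
      rw [e1, e2]

end Innovations

theorem toReal_eLpNorm_two_sq {f : Ω → ℝ} (hf : MemLp f 2 P) :
    (eLpNorm f 2 P).toReal ^ 2 = ∫ ω, f ω ^ 2 ∂P := by
  rw [hf.eLpNorm_eq_integral_rpow_norm two_ne_zero ENNReal.ofNat_ne_top,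
    ENNReal.toReal_ofReal (by positivity)]
  simp only [ENNReal.toReal_ofNat, Real.rpow_two, Real.norm_eq_abs, sq_abs]
  rw [← Real.rpow_natCast, ← Real.rpow_mul (by positivity)]
  norm_num

theorem integral_add_sq_le {f g : Ω → ℝ} (hf : MemLp f 2 P) (hg : MemLp g 2 P) :
    ∫ ω, (f ω + g ω) ^ 2 ∂P ≤ 2 * ∫ ω, f ω ^ 2 ∂P + 2 * ∫ ω, g ω ^ 2 ∂P := by
  rw [← integral_const_mul, ← integral_const_mul,
    ← integral_add (hf.integrable_sq.const_mul _) (hg.integrable_sq.const_mul _)]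
  refine integral_mono (hf.add hg).integrable_sq
    ((hf.integrable_sq.const_mul _).add (hg.integrable_sq.const_mul _)) fun ω => ?_
  nlinarith [sq_nonneg (f ω - g ω)]

/-- Young's inequality with weight `δ`: `2|fg| ≤ δ⁻¹ f² + δ g²`. -/
theorem integral_abs_mul_le {f g : Ω → ℝ} (hf : MemLp f 2 P) (hg : MemLp g 2 P) {δ K : ℝ}
    (hδ : 0 < δ) (hfδ : ∫ ω, f ω ^ 2 ∂P ≤ δ ^ 2) (hgK : ∫ ω, g ω ^ 2 ∂P ≤ K) :
    ∫ ω, |f ω * g ω| ∂P ≤ δ * (1 + K) := by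
  calc ∫ ω, |f ω * g ω| ∂P ≤ ∫ ω, (δ⁻¹ * f ω ^ 2 + δ * g ω ^ 2) ∂P := by
        refine integral_mono (hf.integrable_mul hg).abs
          ((hf.integrable_sq.const_mul _).add (hg.integrable_sq.const_mul _)) fun ω => ?_
        have h1 : δ⁻¹ * f ω ^ 2 + δ * g ω ^ 2 - 2 * (|f ω| * |g ω|)
            = δ⁻¹ * (|f ω| - δ * |g ω|) ^ 2 := by
          rw [← sq_abs (f ω), ← sq_abs (g ω)]
          field_simp
          ring
        have h2 : 0 ≤ δ⁻¹ * (|f ω| - δ * |g ω|) ^ 2 := by positivity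
        have h3 : 0 ≤ |f ω| * |g ω| := by positivity
        simp only [abs_mul]
        linarith
    _ = δ⁻¹ * ∫ ω, f ω ^ 2 ∂P + δ * ∫ ω, g ω ^ 2 ∂P := by
        rw [integral_add (hf.integrable_sq.const_mul _) (hg.integrable_sq.const_mul _),
          integral_const_mul, integral_const_mul]
    _ ≤ δ⁻¹ * δ ^ 2 + δ * K := by gcongr
    _ = δ * (1 + K) := by field_simp

/-! ### Truncated linear filters -/

section Truncation

variable {d : ℕ} {η : ℤ → Ω → EuclideanSpace ℝ (Fin d)}

theorem measurable_linearForm (c : Fin d → ℝ) :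
    Measurable fun v : EuclideanSpace ℝ (Fin d) => ∑ l, c l * v l := by fun_prop

theorem linearForm_sq_le (c : Fin d → ℝ) (v : EuclideanSpace ℝ (Fin d)) :
    (∑ l, c l * v l) ^ 2 ≤ (∑ l, c l ^ 2) * ‖v‖ ^ 2 := by
  rw [EuclideanSpace.real_norm_sq_eq]
  exact Finset.sum_mul_sq_le_sq_mul_sq _ _ _

theorem memLp_linearForm [IsFiniteMeasure P] (h2 : MemLp (η 0) 2 P) (c : Fin d → ℝ) :
    MemLp (fun ω => ∑ l, c l * η 0 ω l) 2 P :=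
  memLp_finsetSum _ fun l _ =>
    (MemLp.const_mul ((EuclideanSpace.proj (𝕜 := ℝ) l).comp_memLp' h2) (c l))

theorem integral_linearForm [IsFiniteMeasure P] (h2 : MemLp (η 0) 2 P) (h0 : ∫ ω, η 0 ω ∂P = 0)
    (c : Fin d → ℝ) : ∫ ω, ∑ l, c l * η 0 ω l ∂P = 0 := by
  have hint : Integrable (η 0) P := h2.integrable one_le_two
  have hl : ∀ l, ∫ ω, η 0 ω l ∂P = 0 := fun l => by
    have := (EuclideanSpace.proj (𝕜 := ℝ) l).integral_comp_comm hint
    rw [h0] at this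
    simpa using this
  have hi : ∀ l, Integrable (fun ω => η 0 ω l) P :=
    fun l => (EuclideanSpace.proj (𝕜 := ℝ) l).integrable_comp hint
  rw [integral_finsetSum _ fun l _ => (hi l).const_mul (c l)]
  simp [integral_const_mul, hl]

/-- `∑_{s ∈ F} C_s η_{t-s}` for one coordinate of a linear process. -/
def partialFilter (η : ℤ → Ω → EuclideanSpace ℝ (Fin d)) (C : ℤ → Fin d → ℝ) (F : Finset ℤ)
    (t : ℤ) (ω : Ω) : ℝ :=
  ∑ s ∈ F, ∑ l, C s l * η (t - s) ω l

variable [IsProbabilityMeasure P] (hind : iIndepFun η P)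
  (hd : ∀ t, IdentDistrib (η t) (η 0) P P) (h2 : MemLp (η 0) 2 P) (h0 : ∫ ω, η 0 ω ∂P = 0)

include hd h2 in
theorem memLp_linearForm_shift (c : Fin d → ℝ) (t : ℤ) :
    MemLp (fun ω => ∑ l, c l * η t ω l) 2 P :=
  ((hd t).comp (measurable_linearForm c)).memLp_iff.2 (memLp_linearForm h2 c)

include hd h2 in
theorem memLp_partialFilter (C : ℤ → Fin d → ℝ) (F : Finset ℤ) (t : ℤ) :
    MemLp (partialFilter η C F t) 2 P :=
  memLp_finsetSum _ fun s _ => memLp_linearForm_shift hd h2 (C s) (t - s)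

include hind hd h2 h0 in
-- Terms with different lags are independent and centred, hence orthogonal; each square is bounded
-- by Cauchy–Schwarz over the innovation coordinates. The bound is uniform in `t`.
theorem integral_partialFilter_sq_le (C : ℤ → Fin d → ℝ) (F : Finset ℤ) (t : ℤ) :
    ∫ ω, partialFilter η C F t ω ^ 2 ∂P ≤ (∑ s ∈ F, ∑ l, C s l ^ 2) * ∫ ω, ‖η 0 ω‖ ^ 2 ∂P := by
  have hid : ∀ (c : Fin d → ℝ) t, IdentDistrib (fun ω => ∑ l, c l * η t ω l) (fun ω => ∑ l, c l * η 0 ω l) P P :=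
    fun c t => (hd t).comp (measurable_linearForm c)
  unfold partialFilter
  rw [integral_sum_sq_of_orthogonal _ (fun s _ => memLp_linearForm_shift hd h2 (C s) (t - s)),
    Finset.sum_mul]
  · refine Finset.sum_le_sum fun s _ => ?_
    have e := ((hid (C s) (t - s)).comp (measurable_id.pow_const 2)).integral_eq
    simp only [Function.comp_def, id] at e
    rw [e, ← integral_const_mul]
    exact integral_mono (memLp_linearForm h2 _).integrable_sq
      ((memLp_two_iff_integrable_sq_norm h2.1).1 h2 |>.const_mul _)
      fun ω => linearForm_sq_le _ _
  · intro s _ s' _ hss'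
    have hi : IndepFun (fun ω => ∑ l, C s l * η (t - s) ω l)
        (fun ω => ∑ l, C s' l * η (t - s') ω l) P :=
      (hind.indepFun (by simpa using hss' : t - s ≠ t - s')).comp
        (measurable_linearForm (C s)) (measurable_linearForm (C s'))
    rw [hi.integral_fun_mul_eq_mul_integral (memLp_linearForm_shift hd h2 _ _).1
      (memLp_linearForm_shift hd h2 _ _).1, (hid _ _).integral_eq, integral_linearForm h2 h0,
      zero_mul]

include hind hd h2 h0 in
theorem meanErgodic_partialFilter_mul (C D : ℤ → Fin d → ℝ) (F G : Finset ℤ) :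
    MeanErgodic P (fun t ω => partialFilter η C F t ω * partialFilter η D G t ω) := by
  simp_rw [partialFilter, Finset.sum_mul_sum (s := F) (t := G)]
  exact MeanErgodic.sum _ fun s _ => MeanErgodic.sum _ fun s' _ =>
    MeanErgodic.mul_of_iid hind hd (measurable_linearForm (C s)) (measurable_linearForm (D s'))
      (memLp_linearForm h2 _) (memLp_linearForm h2 _) (integral_linearForm h2 h0 _)
      (integral_linearForm h2 h0 _) s s'

include hind hd h2 h0 in
-- Mean square convergence is given for each `t` separately. Uniformity in `t` comes from choosing
-- `N` by the tail of the squared coefficients alone.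
theorem integral_sub_partialFilter_sq_le {w : ℤ → Ω → ℝ} {C : ℤ → Fin d → ℝ}
    (hC : ∀ l, Summable fun s => C s l ^ 2) (hw : ∀ t, MemLp (w t) 2 P)
    (hlim : ∀ t, Tendsto (fun N : ℕ => eLpNorm
      (fun ω => w t ω - partialFilter η C (Finset.Icc (-(N : ℤ)) N) t ω) 2 P) atTop (𝓝 0))
    {δ : ℝ} (hδ : 0 < δ) :
    ∃ N : ℕ, ∀ t,
      ∫ ω, (w t ω - partialFilter η C (Finset.Icc (-(N : ℤ)) N) t ω) ^ 2 ∂P ≤ δ := by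
  set K := ∫ ω, ‖η 0 ω‖ ^ 2 ∂P with hK
  have hK0 : 0 ≤ K := integral_nonneg fun ω => by positivity
  have hsum : Summable fun s => ∑ l, C s l ^ 2 := summable_sum fun l _ => hC l
  obtain ⟨S, hS⟩ := summable_iff_vanishing_norm.1 hsum (δ / (4 * (K + 1))) (by positivity)
  obtain ⟨N, hN⟩ : ∃ N : ℕ, S ⊆ Finset.Icc (-(N : ℤ)) N := by
    refine ⟨∑ s ∈ S, s.natAbs, fun s hs => ?_⟩
    have := Finset.single_le_sum (f := fun s : ℤ => s.natAbs) (fun _ _ => Nat.zero_le _) hs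
    rw [Finset.mem_Icc]
    lia
  refine ⟨N, fun t => ?_⟩
  have hsq : Tendsto (fun M : ℕ =>
      ∫ ω, (w t ω - partialFilter η C (Finset.Icc (-(M : ℤ)) M) t ω) ^ 2 ∂P) atTop (𝓝 0) := by
    have h := ((ENNReal.tendsto_toReal ENNReal.zero_ne_top).comp (hlim t)).pow 2
    simp only [ENNReal.toReal_zero, ne_eq, OfNat.ofNat_ne_zero, not_false_eq_true, zero_pow] at h
    exact h.congr fun M => toReal_eLpNorm_two_sq ((hw t).sub (memLp_partialFilter hd h2 C _ t))
  -- `M` may depend on `t`; it only serves as an intermediate filter, whose distance to the one cut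
  -- at `N` is controlled by the coefficient tail.
  obtain ⟨M, hM, hNM⟩ := ((hsq.eventually_lt_const (by positivity : 0 < δ / 4)).and
    (eventually_ge_atTop N)).exists
  have hsub : Finset.Icc (-(N : ℤ)) N ⊆ Finset.Icc (-(M : ℤ)) M :=
    Finset.Icc_subset_Icc (by lia) (by lia)
  have hdec : ∀ ω, w t ω - partialFilter η C (Finset.Icc (-(N : ℤ)) N) t ω
      = (w t ω - partialFilter η C (Finset.Icc (-(M : ℤ)) M) t ω)
        + partialFilter η C (Finset.Icc (-(M : ℤ)) M \ Finset.Icc (-(N : ℤ)) N) t ω := fun ω => by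
    simp only [partialFilter, ← Finset.sum_sdiff hsub]
    ring
  simp_rw [hdec]
  have h1 := integral_add_sq_le ((hw t).sub (memLp_partialFilter hd h2 C (Finset.Icc (-(M : ℤ)) M) t))
    (memLp_partialFilter hd h2 C (Finset.Icc (-(M : ℤ)) M \ Finset.Icc (-(N : ℤ)) N) t)
  simp only [Pi.sub_apply] at h1
  refine h1.trans ?_
  have h3 := integral_partialFilter_sq_le hind hd h2 h0 C
    (Finset.Icc (-(M : ℤ)) M \ Finset.Icc (-(N : ℤ)) N) t
  have h4 := (le_abs_self _).trans (hS (Finset.Icc (-(M : ℤ)) M \ Finset.Icc (-(N : ℤ)) N)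
    (Finset.sdiff_disjoint.mono_right hN)).le
  have h5 : (∑ s ∈ Finset.Icc (-(M : ℤ)) M \ Finset.Icc (-(N : ℤ)) N, ∑ l, C s l ^ 2) * K
      ≤ δ / 4 := by
    calc _ ≤ δ / (4 * (K + 1)) * (K + 1) := by gcongr; linarith
      _ = δ / 4 := by field_simp
  linarith

end Truncation

theorem IsLinearProcess.memLp {κ : Type*} {w : ℤ → Ω → κ → ℝ} (hw : IsLinearProcess P w) (t : ℤ)
    (k : κ) : MemLp (fun ω => w t ω k) 2 P := by
  obtain ⟨d, η, C, -, -, -, -, -, h⟩ := hw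
  exact (h t k).1

/-- The law of large numbers for the products of two coordinates of a linear process. -/
theorem IsLinearProcess.meanErgodic_mul [IsProbabilityMeasure P] {κ : Type*} {w : ℤ → Ω → κ → ℝ}
    (hw : IsLinearProcess P w) (k l : κ) : MeanErgodic P (fun t ω => w t ω k * w t ω l) := by
  obtain ⟨d, η, C, hind, hd, h2, h0, hC, h⟩ := hw
  have hap : ∀ k, ∀ δ > 0, ∃ N : ℕ, ∀ t, ∫ ω, (w t ω k
      - partialFilter η (fun s => C s k) (Finset.Icc (-(N : ℤ)) N) t ω) ^ 2 ∂P ≤ δ :=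
    fun k δ hδ => integral_sub_partialFilter_sq_le hind hd h2 h0 (hC k) (fun t => (h t k).1)
      (fun t => (h t k).2) hδ
  have hbd : ∀ k, ∃ K, ∀ t, ∫ ω, w t ω k ^ 2 ∂P ≤ K := fun k => by
    obtain ⟨N, hN⟩ := hap k 1 one_pos
    refine ⟨2 * 1 + 2 * ((∑ s ∈ Finset.Icc (-(N : ℤ)) N, ∑ j, C s k j ^ 2) *
      ∫ ω, ‖η 0 ω‖ ^ 2 ∂P), fun t => ?_⟩
    have hp := memLp_partialFilter hd h2 (fun s => C s k) (Finset.Icc (-(N : ℤ)) N) t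
    have h1 := integral_add_sq_le ((h t k).1.sub hp) hp
    simp only [Pi.sub_apply, sub_add_cancel] at h1
    have h3 := integral_partialFilter_sq_le hind hd h2 h0 (fun s => C s k)
      (Finset.Icc (-(N : ℤ)) N) t
    linarith [hN t]
  refine MeanErgodic.of_approx (fun t => (h t k).1.integrable_mul (h t l).1) fun ε hε => ?_
  obtain ⟨K, hK⟩ := hbd k
  obtain ⟨L, hL⟩ := hbd l
  -- This is the total error in `w_k w_l - f g = (w_k - f) w_l + (w_l - g) f`, with `2 δ² + 2 K`
  -- bounding the second moment of the filter `f`. It is continuous in `δ` and vanishes at zero.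
  obtain ⟨δ, hδ0, hδ⟩ : ∃ δ : ℝ, 0 < δ ∧ δ * (1 + L) + δ * (1 + (2 * δ ^ 2 + 2 * K)) ≤ ε := by
    have hc : Continuous fun δ : ℝ => δ * (1 + L) + δ * (1 + (2 * δ ^ 2 + 2 * K)) := by fun_prop
    have := (hc.tendsto 0).eventually_lt_const (by simpa using hε)
    obtain ⟨δ, h1, h2⟩ := ((this.filter_mono nhdsWithin_le_nhds).and
      (self_mem_nhdsWithin (s := Set.Ioi 0))).exists
    exact ⟨δ, h2, h1.le⟩
  obtain ⟨N, hN⟩ := hap k (δ ^ 2) (by positivity)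
  obtain ⟨M, hM⟩ := hap l (δ ^ 2) (by positivity)
  refine ⟨_, meanErgodic_partialFilter_mul hind hd h2 h0 (fun s => C s k) (fun s => C s l)
    (Finset.Icc (-(N : ℤ)) N) (Finset.Icc (-(M : ℤ)) M), fun t => ?_⟩
  set f := partialFilter η (fun s => C s k) (Finset.Icc (-(N : ℤ)) N) t
  set g := partialFilter η (fun s => C s l) (Finset.Icc (-(M : ℤ)) M) t
  have hf : MemLp f 2 P := memLp_partialFilter hd h2 _ _ t
  have hdk : MemLp (fun ω => w t ω k - f ω) 2 P := (h t k).1.sub hf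
  have hdl : MemLp (fun ω => w t ω l - g ω) 2 P := (h t l).1.sub (memLp_partialFilter hd h2 _ _ t)
  have hfb : ∫ ω, f ω ^ 2 ∂P ≤ 2 * δ ^ 2 + 2 * K := by
    have h1 := integral_add_sq_le hdk.neg (h t k).1
    simp only [Pi.neg_apply, neg_sub, sub_add_cancel] at h1
    have h3 : ∫ ω, (f ω - w t ω k) ^ 2 ∂P ≤ δ ^ 2 := by
      refine le_trans (le_of_eq ?_) (hN t)
      congr 1 with ω
      ring
    linarith [hK t]
  have i1 := integral_abs_mul_le hdk (h t l).1 hδ0 (hN t) (hL t)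
  have i2 := integral_abs_mul_le hdl hf hδ0 (hM t) hfb
  calc ∫ ω, |w t ω k * w t ω l - f ω * g ω| ∂P
      ≤ ∫ ω, (|(w t ω k - f ω) * w t ω l| + |(w t ω l - g ω) * f ω|) ∂P := by
        refine integral_mono_of_nonneg (ae_of_all _ fun ω => abs_nonneg _)
          ((hdk.integrable_mul (h t l).1).abs.add (hdl.integrable_mul hf).abs)
          (ae_of_all _ fun ω => ?_)
        refine le_trans (le_of_eq ?_) (abs_add_le _ _)
        simp only
        ring_nf
    _ ≤ ε := by
        rw [integral_add (by exact (hdk.integrable_mul (h t l).1).abs)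
          (by exact (hdl.integrable_mul hf).abs)]
        linarith

/-! ### Least squares as a function of the sample moments -/

section LeastSquares

variable {p : ℕ}

theorem selMatrix_mulVec (γ : Model p) (v : Fin p → ℝ) (j : Fin p) :
    (selMatrix γ *ᵥ v) j = if γ j then v j else 0 := by
  simp [selMatrix, Matrix.mulVec_diagonal]

theorem selMatrix_mul_self (γ : Model p) : selMatrix γ * selMatrix γ = selMatrix γ := by
  rw [selMatrix, Matrix.diagonal_mul_diagonal]
  congr 1 with i
  by_cases h : γ i <;> simp [h]

theorem selMatrix_transpose (γ : Model p) : (selMatrix γ)ᵀ = selMatrix γ :=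
  Matrix.diagonal_transpose _

/-- The matrix which is `S` on the coordinates selected by `γ` and the identity on the others. -/
def normalMatrix (γ : Model p) (S : Matrix (Fin p) (Fin p) ℝ) : Matrix (Fin p) (Fin p) ℝ :=
  selMatrix γ * S * selMatrix γ + (1 - selMatrix γ)

/-- The coefficients of the linear projection on the regressors in `γ`, when these have second
moments `S` and cross moments `v` with the dependent variable. -/
noncomputable def projCoef (γ : Model p) (S : Matrix (Fin p) (Fin p) ℝ) (v : Fin p → ℝ) : Fin p → ℝ :=
  (normalMatrix γ S)⁻¹ *ᵥ (selMatrix γ *ᵥ v)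

/-- The mean squared error of the linear projection on the regressors in `γ`; here `c` is the second
moment of the dependent variable. -/
noncomputable def projRisk (γ : Model p) (S : Matrix (Fin p) (Fin p) ℝ) (v : Fin p → ℝ) (c : ℝ) : ℝ :=
  c - 2 * (projCoef γ S v ⬝ᵥ v) + projCoef γ S v ⬝ᵥ (S *ᵥ projCoef γ S v)

theorem selMatrix_mul_normalMatrix (γ : Model p) (S : Matrix (Fin p) (Fin p) ℝ) :
    selMatrix γ * normalMatrix γ S = selMatrix γ * S * selMatrix γ := by
  simp [normalMatrix, Matrix.mul_add, Matrix.mul_sub, selMatrix_mul_self, ← Matrix.mul_assoc]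

theorem normalMatrix_mul_selMatrix (γ : Model p) (S : Matrix (Fin p) (Fin p) ℝ) :
    normalMatrix γ S * selMatrix γ = selMatrix γ * S * selMatrix γ := by
  simp [normalMatrix, Matrix.add_mul, Matrix.sub_mul, selMatrix_mul_self, Matrix.mul_assoc]

theorem normalMatrix_mulVec (γ : Model p) (S : Matrix (Fin p) (Fin p) ℝ) (b : Fin p → ℝ)
    (j : Fin p) :
    (normalMatrix γ S *ᵥ b) j = if γ j then (S *ᵥ (selMatrix γ *ᵥ b)) j else b j := by
  rw [normalMatrix, Matrix.add_mulVec, Matrix.sub_mulVec, Matrix.one_mulVec, Pi.add_apply,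
    Pi.sub_apply, ← Matrix.mulVec_mulVec, ← Matrix.mulVec_mulVec, selMatrix_mulVec,
    selMatrix_mulVec]
  by_cases h : γ j <;> simp [h]

theorem projCoef_eq {γ : Model p} {S : Matrix (Fin p) (Fin p) ℝ} {v b : Fin p → ℝ}
    (hdet : IsUnit (normalMatrix γ S).det) (h1 : ∀ j, γ j → (S *ᵥ b) j = v j)
    (h2 : ∀ j, ¬ γ j → b j = 0) : projCoef γ S v = b := by
  have hb : selMatrix γ *ᵥ b = b := by
    funext j
    rw [selMatrix_mulVec]
    by_cases h : γ j
    · simp [h]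
    · simp [h, h2 j h]
  have : selMatrix γ *ᵥ v = normalMatrix γ S *ᵥ b := by
    funext j
    rw [selMatrix_mulVec, normalMatrix_mulVec, hb]
    by_cases h : γ j
    · simp [h, h1 j h]
    · simp [h, h2 j h]
  rw [projCoef, this, Matrix.mulVec_mulVec, Matrix.nonsing_inv_mul _ hdet, Matrix.one_mulVec]

theorem normalMatrix_mulVec_projCoef {γ : Model p} {S : Matrix (Fin p) (Fin p) ℝ}
    (hdet : IsUnit (normalMatrix γ S).det) (v : Fin p → ℝ) :
    normalMatrix γ S *ᵥ projCoef γ S v = selMatrix γ *ᵥ v := by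
  rw [projCoef, Matrix.mulVec_mulVec, Matrix.mul_nonsing_inv _ hdet, Matrix.one_mulVec]

theorem projCoef_apply_of_not {γ : Model p} {S : Matrix (Fin p) (Fin p) ℝ}
    (hdet : IsUnit (normalMatrix γ S).det) (v : Fin p → ℝ) {j : Fin p} (hj : ¬ γ j) :
    projCoef γ S v j = 0 := by
  have h := congrFun (normalMatrix_mulVec_projCoef hdet v) j
  rwa [normalMatrix_mulVec, selMatrix_mulVec, if_neg hj, if_neg hj] at h

theorem mulVec_projCoef_apply {γ : Model p} {S : Matrix (Fin p) (Fin p) ℝ}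
    (hdet : IsUnit (normalMatrix γ S).det) (v : Fin p → ℝ) {j : Fin p} (hj : γ j) :
    (S *ᵥ projCoef γ S v) j = v j := by
  have h := congrFun (normalMatrix_mulVec_projCoef hdet v) j
  have hb : selMatrix γ *ᵥ projCoef γ S v = projCoef γ S v := by
    funext i
    rw [selMatrix_mulVec]
    by_cases hi : γ i
    · simp [hi]
    · simp [hi, projCoef_apply_of_not hdet v hi]
  rwa [normalMatrix_mulVec, selMatrix_mulVec, if_pos hj, if_pos hj, hb] at h

/-- A kernel vector vanishes off `γ`, while on `γ` its image under `S` vanishes. Its quadratic form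
is therefore zero, against positive definiteness. -/
theorem isUnit_det_normalMatrix {S : Matrix (Fin p) (Fin p) ℝ} (hS : S.PosDef) (γ : Model p) :
    IsUnit (normalMatrix γ S).det := by
  rw [isUnit_iff_ne_zero]
  intro hdet
  obtain ⟨b, hb0, hb⟩ := Matrix.exists_mulVec_eq_zero_iff.2 hdet
  refine hb0 ?_
  have hcoord := fun j => normalMatrix_mulVec γ S b j
  simp only [hb, Pi.zero_apply] at hcoord
  have hnot : ∀ j, ¬ γ j → b j = 0 := fun j hj => by simpa [hj] using (hcoord j).symm
  have hsel : selMatrix γ *ᵥ b = b := by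
    funext j
    rw [selMatrix_mulVec]
    by_cases h : γ j
    · simp [h]
    · simp [h, hnot j h]
  by_contra hne
  have hpos := hS.dotProduct_mulVec_pos hne
  refine hpos.ne' (Finset.sum_eq_zero fun j _ => ?_)
  by_cases h : γ j
  · have := hcoord j
    rw [if_pos h, hsel] at this
    rw [← this, mul_zero]
  · simp [hnot j h]

/-- Sample second moments of the regressors. -/
noncomputable def sampleMoment {n : ℕ} (X : Matrix (Fin n) (Fin p) ℝ) : Matrix (Fin p) (Fin p) ℝ :=
  (n : ℝ)⁻¹ • (Xᵀ * X)

/-- Sample cross moments of the regressors with the dependent variable. -/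
noncomputable def sampleCross {n : ℕ} (X : Matrix (Fin n) (Fin p) ℝ) (y : Fin n → ℝ) : Fin p → ℝ :=
  (n : ℝ)⁻¹ • (Xᵀ *ᵥ y)

/-- `D` commutes with `A`, hence with `A⁻¹`, so both products of the two matrices equal the
symmetric idempotent `D` and the Penrose equations follow. This trades the pseudoinverse, which is
not continuous in general, for an ordinary inverse, continuous where the determinant is nonzero. -/
theorem pinv_normalEquations {n : ℕ} (hn : n ≠ 0) (X : Matrix (Fin n) (Fin p) ℝ) (γ : Model p)
    (hdet : IsUnit (normalMatrix γ (sampleMoment X)).det) :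
    pinv (selMatrix γ * Xᵀ * X * selMatrix γ)
      = (n : ℝ)⁻¹ • ((normalMatrix γ (sampleMoment X))⁻¹ * selMatrix γ) := by
  have hn' : (n : ℝ) ≠ 0 := by exact_mod_cast hn
  set D := selMatrix γ with hD
  set A := normalMatrix γ (sampleMoment X) with hA
  have hDD : D * D = D := selMatrix_mul_self γ
  have hM : D * Xᵀ * X * D = (n : ℝ) • (D * A) := by
    rw [hA, hD, selMatrix_mul_normalMatrix, sampleMoment, Matrix.mul_smul, Matrix.smul_mul,
      smul_smul, mul_inv_cancel₀ hn', one_smul]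
    simp only [Matrix.mul_assoc]
  have hcomm : D * A = A * D := by
    rw [hA, hD, selMatrix_mul_normalMatrix, normalMatrix_mul_selMatrix]
  have hcomm' : A⁻¹ * D = D * A⁻¹ := by
    calc A⁻¹ * D = A⁻¹ * (D * (A * A⁻¹)) := by rw [Matrix.mul_nonsing_inv _ hdet, Matrix.mul_one]
      _ = A⁻¹ * (D * A) * A⁻¹ := by simp only [Matrix.mul_assoc]
      _ = D * A⁻¹ := by rw [hcomm, ← Matrix.mul_assoc, Matrix.nonsing_inv_mul _ hdet,
          Matrix.one_mul]
  have hMB : D * A * (A⁻¹ * D) = D := by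
    rw [Matrix.mul_assoc, ← Matrix.mul_assoc A, Matrix.mul_nonsing_inv _ hdet, Matrix.one_mul, hDD]
  have hBM : A⁻¹ * D * (D * A) = D := by
    rw [hcomm', Matrix.mul_assoc, hcomm, ← Matrix.mul_assoc, ← Matrix.mul_assoc, Matrix.mul_assoc D,
      Matrix.nonsing_inv_mul _ hdet, Matrix.mul_one, hDD]
  refine (isMoorePenrose_pinv _).unique ?_
  rw [hM]
  have e1 : (n : ℝ) • (D * A) * ((n : ℝ)⁻¹ • (A⁻¹ * D)) = D := by
    rw [Matrix.smul_mul, Matrix.mul_smul, smul_smul, mul_inv_cancel₀ hn', one_smul, hMB]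
  have e2 : ((n : ℝ)⁻¹ • (A⁻¹ * D)) * ((n : ℝ) • (D * A)) = D := by
    rw [Matrix.smul_mul, Matrix.mul_smul, smul_smul, inv_mul_cancel₀ hn', one_smul, hBM]
  refine ⟨?_, ?_, ?_, ?_⟩
  · rw [e1, Matrix.mul_smul, ← Matrix.mul_assoc, hDD]
  · rw [e2, Matrix.mul_smul, hcomm', ← Matrix.mul_assoc, hDD]
  · rw [e1, hD, selMatrix_transpose]
  · rw [e2, hD, selMatrix_transpose]

theorem sigmaHatSq_eq_projRisk {n : ℕ} (hn : n ≠ 0) (X : Matrix (Fin n) (Fin p) ℝ)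
    (y : Fin n → ℝ) (γ : Model p) (hdet : IsUnit (normalMatrix γ (sampleMoment X)).det) :
    sigmaHatSq X y γ
      = projRisk γ (sampleMoment X) (sampleCross X y) ((n : ℝ)⁻¹ * (y ⬝ᵥ y)) := by
  have hb : olsEstimator X y γ = projCoef γ (sampleMoment X) (sampleCross X y) := by
    rw [olsEstimator, pinv_normalEquations hn X γ hdet, projCoef, sampleCross, Matrix.smul_mul,
      Matrix.smul_mul, Matrix.smul_mulVec, Matrix.mul_assoc _ (selMatrix γ) (selMatrix γ),
      selMatrix_mul_self, Matrix.mulVec_smul, Matrix.mulVec_smul]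
    simp only [Matrix.mulVec_mulVec, Matrix.mul_assoc]
  rw [sigmaHatSq, projRisk, residual, hb]
  set b := projCoef γ (sampleMoment X) (sampleCross X y)
  have h1 : b ⬝ᵥ sampleCross X y = (n : ℝ)⁻¹ * ((X *ᵥ b) ⬝ᵥ y) := by
    rw [sampleCross, dotProduct_smul, smul_eq_mul, Matrix.dotProduct_mulVec,
      Matrix.vecMul_transpose]
  have h2 : b ⬝ᵥ (sampleMoment X *ᵥ b) = (n : ℝ)⁻¹ * ((X *ᵥ b) ⬝ᵥ (X *ᵥ b)) := by
    rw [sampleMoment, Matrix.smul_mulVec, dotProduct_smul, smul_eq_mul, ← Matrix.mulVec_mulVec,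
      Matrix.dotProduct_mulVec b Xᵀ, Matrix.vecMul_transpose]
  rw [h1, h2, sub_dotProduct, dotProduct_sub, dotProduct_sub, dotProduct_comm y (X *ᵥ b)]
  ring

theorem continuousAt_projCoef {γ : Model p} {S : Matrix (Fin p) (Fin p) ℝ} {v : Fin p → ℝ}
    (hdet : IsUnit (normalMatrix γ S).det) :
    ContinuousAt (fun z : Matrix (Fin p) (Fin p) ℝ × (Fin p → ℝ) => projCoef γ z.1 z.2) (S, v) := by
  have hA : Continuous fun z : Matrix (Fin p) (Fin p) ℝ × (Fin p → ℝ) => normalMatrix γ z.1 := by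
    unfold normalMatrix
    fun_prop
  have hinv : ContinuousAt (fun z : Matrix (Fin p) (Fin p) ℝ × (Fin p → ℝ) =>
      (normalMatrix γ z.1)⁻¹) (S, v) := by
    have hd : ContinuousAt (fun z : Matrix (Fin p) (Fin p) ℝ × (Fin p → ℝ) =>
        (normalMatrix γ z.1).det) (S, v) := hA.matrix_det.continuousAt
    have hadj : ContinuousAt (fun z : Matrix (Fin p) (Fin p) ℝ × (Fin p → ℝ) =>
        (normalMatrix γ z.1).adjugate) (S, v) := hA.matrix_adjugate.continuousAt
    simp only [Matrix.inv_def, Ring.inverse_eq_inv']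
    exact (hd.inv₀ hdet.ne_zero).smul hadj
  have hm : Continuous fun q : Matrix (Fin p) (Fin p) ℝ × (Fin p → ℝ) => q.1 *ᵥ q.2 := by fun_prop
  have hv : Continuous fun z : Matrix (Fin p) (Fin p) ℝ × (Fin p → ℝ) => selMatrix γ *ᵥ z.2 := by
    fun_prop
  exact ContinuousAt.comp (f := fun z : Matrix (Fin p) (Fin p) ℝ × (Fin p → ℝ) =>
    ((normalMatrix γ z.1)⁻¹, selMatrix γ *ᵥ z.2)) hm.continuousAt (hinv.prodMk hv.continuousAt)

theorem continuousAt_projRisk {γ : Model p} {S : Matrix (Fin p) (Fin p) ℝ} {v : Fin p → ℝ} {c : ℝ}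
    (hdet : IsUnit (normalMatrix γ S).det) :
    ContinuousAt (fun z : Matrix (Fin p) (Fin p) ℝ × (Fin p → ℝ) × ℝ =>
      projRisk γ z.1 z.2.1 z.2.2) (S, v, c) := by
  have hb : ContinuousAt (fun z : Matrix (Fin p) (Fin p) ℝ × (Fin p → ℝ) × ℝ =>
      projCoef γ z.1 z.2.1) (S, v, c) :=
    ContinuousAt.comp (g := fun z : Matrix (Fin p) (Fin p) ℝ × (Fin p → ℝ) => projCoef γ z.1 z.2)
      (f := fun z : Matrix (Fin p) (Fin p) ℝ × (Fin p → ℝ) × ℝ => (z.1, z.2.1))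
      (continuousAt_projCoef hdet) (by fun_prop)
  have hF : Continuous fun q : (Matrix (Fin p) (Fin p) ℝ × (Fin p → ℝ) × ℝ) × (Fin p → ℝ) =>
      q.1.2.2 - 2 * (q.2 ⬝ᵥ q.1.2.1) + q.2 ⬝ᵥ (q.1.1 *ᵥ q.2) := by fun_prop
  exact ContinuousAt.comp (f := fun z : Matrix (Fin p) (Fin p) ℝ × (Fin p → ℝ) × ℝ =>
    (z, projCoef γ z.1 z.2.1)) hF.continuousAt (continuousAt_id.prodMk hb)

end LeastSquares

/-! ### The population values in the linear model -/

section Population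

variable {p : ℕ} {S : Matrix (Fin p) (Fin p) ℝ} {β : Fin p → ℝ} {s : ℝ}

/-- The limit of the residual variance of model `γ`. -/
noncomputable def limitRisk (S : Matrix (Fin p) (Fin p) ℝ) (β : Fin p → ℝ) (s : ℝ) (γ : Model p) : ℝ :=
  projRisk γ S (S *ᵥ β) (β ⬝ᵥ (S *ᵥ β) + s)

/-- Completing the square; optimality of the projection plays no role. -/
theorem limitRisk_eq (hS : Sᵀ = S) (γ : Model p) :
    limitRisk S β s γ
      = s + (β - projCoef γ S (S *ᵥ β)) ⬝ᵥ (S *ᵥ (β - projCoef γ S (S *ᵥ β))) := by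
  rw [limitRisk, projRisk]
  set b := projCoef γ S (S *ᵥ β)
  have h : b ⬝ᵥ (S *ᵥ β) = β ⬝ᵥ (S *ᵥ b) := by
    rw [Matrix.dotProduct_mulVec, dotProduct_comm, ← Matrix.mulVec_transpose, hS]
  rw [Matrix.mulVec_sub, sub_dotProduct, dotProduct_sub, dotProduct_sub, h]
  ring

theorem limitRisk_pos (hS : S.PosDef) (hs : 0 < s) (γ : Model p) : 0 < limitRisk S β s γ := by
  rw [limitRisk_eq (by simpa using hS.isHermitian.eq)]
  have := hS.posSemidef.dotProduct_mulVec_nonneg (β - projCoef γ S (S *ᵥ β))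
  simp only [star_trivial] at this
  linarith

theorem limitRisk_all (hS : S.PosDef) : limitRisk S β s (fun _ => true) = s := by
  rw [limitRisk_eq (by simpa using hS.isHermitian.eq),
    projCoef_eq (b := β) (isUnit_det_normalMatrix hS _) (fun _ _ => rfl) (by simp)]
  simp

/-- The projection has coefficient zero at the omitted `i`, so it cannot equal `β`, and the
quadratic form at the difference is positive. -/
theorem lt_limitRisk (hS : S.PosDef) {γ : Model p} {i : Fin p} (hi : ¬ γ i) (hβ : β i ≠ 0) :
    s < limitRisk S β s γ := by
  rw [limitRisk_eq (by simpa using hS.isHermitian.eq)]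
  have hne : β - projCoef γ S (S *ᵥ β) ≠ 0 := fun h => by
    have := congrFun h i
    rw [Pi.sub_apply, projCoef_apply_of_not (isUnit_det_normalMatrix hS _) _ hi] at this
    simp [hβ] at this
  have := hS.dotProduct_mulVec_pos hne
  simp only [star_trivial] at this
  linarith

/-- Under orthogonality, the irrelevant regressors do not matter for the projection. -/
theorem projCoef_inter_trueSet (hS : S.PosDef)
    (horth : ∀ j ∈ trueSet β, ∀ l ∉ trueSet β, S l j = 0) (γ : Model p) :
    projCoef γ S (S *ᵥ β) = projCoef (fun i => γ i && decide (i ∈ trueSet β)) S (S *ᵥ β) := by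
  have hdet := isUnit_det_normalMatrix hS (fun i => γ i && decide (i ∈ trueSet β))
  have hzero : ∀ b : Fin p → ℝ, (∀ j ∉ trueSet β, b j = 0) → ∀ l ∉ trueSet β,
      (S *ᵥ b) l = 0 := fun b hb l hl => by
    rw [Matrix.mulVec, dotProduct]
    refine Finset.sum_eq_zero fun j _ => ?_
    by_cases hj : j ∈ trueSet β
    · rw [horth j hj l hl, zero_mul]
    · rw [hb j hj, mul_zero]
  -- The projection on the true regressors of `γ` solves the normal equations of `γ`: in the
  -- irrelevant rows both sides vanish, because `S` maps vectors supported on the true set to such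
  -- vectors.
  refine projCoef_eq (isUnit_det_normalMatrix hS _) (fun j hj => ?_) (fun j hj => ?_)
  · by_cases hjT : j ∈ trueSet β
    · exact mulVec_projCoef_apply hdet _ (by simp [hj, hjT])
    · rw [hzero β (fun i hi => by simpa [trueSet] using hi) j hjT]
      exact hzero _ (fun i hi => projCoef_apply_of_not hdet _ (by simp [hi])) j hjT
  · exact projCoef_apply_of_not hdet _ (by simp [hj])

theorem limitRisk_combine (hS : S.PosDef)
    (horth : ∀ j ∈ trueSet β, ∀ l ∉ trueSet β, S l j = 0) {i : Fin p} (hi : i ∉ trueSet β)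
    (b b' : Bool) (g : {j : Fin p // j ≠ i} → Bool) :
    limitRisk S β s (combine i b g) = limitRisk S β s (combine i b' g) := by
  have h : (fun k => combine i b g k && decide (k ∈ trueSet β))
      = fun k => combine i b' g k && decide (k ∈ trueSet β) := by
    funext k
    by_cases hk : k = i
    · subst hk; simp [hi]
    · simp [combine, hk]
  rw [limitRisk, limitRisk, projRisk, projRisk, projCoef_inter_trueSet hS horth (combine i b g), h,
    ← projCoef_inter_trueSet hS horth (combine i b' g)]

end Population

/-! ### Sensitivity indices -/

section Sensitivity

theorem unifVar_nonneg {α : Type*} [Fintype α] (f : α → ℝ) : 0 ≤ unifVar f :=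
  Finset.expect_nonneg fun _ _ => sq_nonneg _

theorem unifVar_pos {α : Type*} [Fintype α] {f : α → ℝ} {a b : α} (h : f a ≠ f b) :
    0 < unifVar f := by
  refine Finset.expect_pos' (fun _ _ => sq_nonneg _) ?_
  by_contra! hc
  have key : ∀ x, f x = 𝔼 y, f y := fun x => by
    have := hc x (Finset.mem_univ x)
    nlinarith [sq_nonneg (f x - 𝔼 y, f y)]
  exact h ((key a).trans (key b).symm)

theorem continuous_unifVar {α : Type*} [Fintype α] : Continuous (unifVar : (α → ℝ) → ℝ) := by
  unfold unifVar
  simp only [Finset.expect, NNRat.smul_def]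
  fun_prop

variable {p : ℕ}

theorem continuous_totalEffectVar (i : Fin p) :
    Continuous fun q : Model p → ℝ => totalEffectVar q i := by
  have h : ∀ g : {j : Fin p // j ≠ i} → Bool,
      Continuous fun q : Model p → ℝ => unifVar fun b : Bool => q (combine i b g) :=
    fun g => continuous_unifVar.comp (by fun_prop)
  unfold totalEffectVar
  simp only [Finset.expect, NNRat.smul_def]
  fun_prop

theorem totalEffectVar_eq_zero {q : Model p → ℝ} {i : Fin p}
    (h : ∀ b b' g, q (combine i b g) = q (combine i b' g)) : totalEffectVar q i = 0 := by
  refine Finset.expect_eq_zero fun g _ => ?_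
  have : (fun b : Bool => q (combine i b g)) = fun _ => q (combine i true g) :=
    funext fun b => h _ _ _
  rw [this]
  simp [unifVar]

theorem totalEffectVar_pos {q : Model p → ℝ} {i : Fin p} (g : {j : Fin p // j ≠ i} → Bool)
    (h : q (combine i true g) ≠ q (combine i false g)) : 0 < totalEffectVar q i :=
  Finset.expect_pos' (fun _ _ => unifVar_nonneg _)
    ⟨g, Finset.mem_univ g, unifVar_pos (a := true) (b := false) h⟩

/-- Counting entries above a level eliminates the sorting permutation; ordered values can then be
compared through cardinalities, with no care for ties. -/
theorem le_decreasing_iff (a : Fin p → ℝ) (r : ℝ) (k : Fin p) :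
    r ≤ decreasing a k ↔ (k : ℕ) < (Finset.univ.filter fun i => r ≤ a i).card := by
  rw [← Tuple.lt_card_ge_iff_apply_ge_of_antitone (antitone_decreasing a)]
  have : (Finset.univ.filter fun i => r ≤ decreasing a i).card
      = (Finset.univ.filter fun i => r ≤ a i).card :=
    Finset.card_equiv (Fin.revPerm.trans (Tuple.sort a)) (fun i => by
      simp only [Finset.mem_filter, Finset.mem_univ, true_and]
      rfl)
  rw [this]

/-- Every index with `a i` at or above the `k`-th ordered value of `a` has `b i` at or above that
value minus `r`. Used in both directions, this makes sorting 1-Lipschitz. -/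
theorem decreasing_le_add {a b : Fin p → ℝ} {r : ℝ} (h : ∀ i, a i ≤ b i + r) (k : Fin p) :
    decreasing a k ≤ decreasing b k + r := by
  rw [← sub_le_iff_le_add, le_decreasing_iff]
  refine ((le_decreasing_iff a _ k).1 le_rfl).trans_le (Finset.card_le_card fun i hi => ?_)
  simp only [Finset.mem_filter, Finset.mem_univ, true_and] at hi ⊢
  linarith [h i]

theorem continuous_decreasing : Continuous (decreasing : (Fin p → ℝ) → Fin p → ℝ) := by
  refine (LipschitzWith.of_dist_le_mul (K := 1) fun a b => ?_).continuous
  rw [NNReal.coe_one, one_mul, dist_pi_le_iff dist_nonneg]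
  intro k
  have hab : ∀ i, |a i - b i| ≤ dist a b := fun i => dist_le_pi_dist a b i
  have h1 := decreasing_le_add (a := a) (b := b) (r := dist a b)
    (fun i => by linarith [(abs_sub_le_iff.1 (hab i)).1]) k
  have h2 := decreasing_le_add (a := b) (b := a) (r := dist a b)
    (fun i => by linarith [(abs_sub_le_iff.1 (hab i)).2]) k
  rw [Real.dist_eq, abs_sub_le_iff]
  exact ⟨by linarith, by linarith⟩

variable {T : Finset (Fin p)}

theorem decreasing_pos {a : Fin p → ℝ} {r : ℝ} (hr : 0 < r) (h : ∀ i ∈ T, r ≤ a i) {k : Fin p}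
    (hk : (k : ℕ) < T.card) : 0 < decreasing a k := by
  refine hr.trans_le ((le_decreasing_iff a r k).2 (hk.trans_le (Finset.card_le_card fun i hi => ?_)))
  simpa using h i hi

theorem decreasing_eq_zero {a : Fin p → ℝ} (h0 : ∀ i, 0 ≤ a i) (h : ∀ i ∉ T, a i = 0) {k : Fin p}
    (hk : T.card ≤ (k : ℕ)) : decreasing a k = 0 := by
  refine le_antisymm (not_lt.1 fun hpos => ?_) ((le_decreasing_iff a 0 k).2 (by simp [h0]))
  refine ((le_decreasing_iff a _ k).1 le_rfl).not_ge (le_trans (Finset.card_le_card fun i hi => ?_) hk)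
  by_contra hiT
  simp only [Finset.mem_filter, h i hiT] at hi
  linarith [hi.2]

/-- The entries reaching level `r` are exactly those of `T`, and in a decreasing arrangement they
form an initial segment of length `T.card`. -/
theorem mem_of_antitone_of_separated {a : Fin p → ℝ} {r : ℝ} (h1 : ∀ i ∈ T, r ≤ a i)
    (h2 : ∀ i ∉ T, a i < r) (π : Equiv.Perm (Fin p)) (hπ : Antitone fun k => a (π k)) (k : Fin p) :
    (k : ℕ) < T.card ↔ π k ∈ T := by
  have hmem : ∀ i, r ≤ a i ↔ i ∈ T := fun i =>
    ⟨fun hi => by_contra fun hiT => (h2 i hiT).not_ge hi, h1 i⟩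
  have h := Tuple.lt_card_ge_iff_apply_ge_of_antitone (j := k) (a := r) hπ
  have hc : (Finset.univ.filter fun i => r ≤ a (π i)).card = T.card :=
    Finset.card_equiv π (by simp [hmem])
  rw [hc] at h
  rw [h, hmem]

end Sensitivity

/-! ### Convergence in probability to a constant -/

section InProbability

/-- Convergence in probability of `Z n` to the constant `z`. -/
def TendstoInProb {α : Type*} [TopologicalSpace α] (P : Measure Ω) (Z : ℕ → Ω → α) (z : α) : Prop :=
  ∀ U ∈ 𝓝 z, Tendsto (fun n => P {ω | Z n ω ∉ U}) atTop (𝓝 0)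

variable {α α' : Type*} [TopologicalSpace α] [TopologicalSpace α']

/-- This form allows `Y` to be a function of `Z` only for large `n` and only while `Z` is near its
limit. -/
theorem TendstoInProb.map_of_eventually {Z : ℕ → Ω → α} {Y : ℕ → Ω → α'} {z : α} {y : α'}
    (hZ : TendstoInProb P Z z)
    (h : ∀ U ∈ 𝓝 y, ∃ W ∈ 𝓝 z, ∀ᶠ n in atTop, ∀ ω, Z n ω ∈ W → Y n ω ∈ U) :
    TendstoInProb P Y y := by
  intro U hU
  obtain ⟨W, hW, hWU⟩ := h U hU
  refine tendsto_of_tendsto_of_tendsto_of_le_of_le' tendsto_const_nhds (hZ W hW)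
    (Eventually.of_forall fun _ => zero_le) ?_
  filter_upwards [hWU] with n hn
  exact measure_mono fun ω hω hW => hω (hn ω hW)

theorem TendstoInProb.map {Z : ℕ → Ω → α} {z : α} (hZ : TendstoInProb P Z z) {f : α → α'}
    (hf : ContinuousAt f z) : TendstoInProb P (fun n ω => f (Z n ω)) (f z) :=
  hZ.map_of_eventually fun U hU => ⟨f ⁻¹' U, hf hU, Eventually.of_forall fun _ _ h => h⟩

theorem TendstoInProb.prodMk {Z : ℕ → Ω → α} {z : α} {Y : ℕ → Ω → α'} {y : α'}
    (hZ : TendstoInProb P Z z) (hY : TendstoInProb P Y y) :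
    TendstoInProb P (fun n ω => (Z n ω, Y n ω)) (z, y) := by
  intro U hU
  obtain ⟨A, hA, B, hB, hAB⟩ := mem_nhds_prod_iff.1 hU
  refine tendsto_of_tendsto_of_tendsto_of_le_of_le tendsto_const_nhds
    (by simpa using (hZ A hA).add (hY B hB)) (fun _ => zero_le) fun n => ?_
  refine (measure_mono fun ω hω => ?_).trans (measure_union_le _ _)
  by_contra hc
  simp only [Set.mem_union, Set.mem_ofPred_eq, not_or, not_not] at hc
  exact hω (hAB hc)

theorem TendstoInProb.pi {ι : Type*} [Fintype ι] {A : ι → Type*} [∀ i, TopologicalSpace (A i)]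
    {Z : ℕ → Ω → ∀ i, A i} {z : ∀ i, A i}
    (h : ∀ i, TendstoInProb P (fun n ω => Z n ω i) (z i)) : TendstoInProb P Z z := by
  intro U hU
  rw [nhds_pi, Filter.mem_pi'] at hU
  obtain ⟨I, t, ht, htU⟩ := hU
  have hsum : Tendsto (fun n => ∑ i ∈ I, P {ω | Z n ω i ∉ t i}) atTop (𝓝 0) := by
    simpa using tendsto_finsetSum I fun i _ => h i (t i) (ht i)
  refine tendsto_of_tendsto_of_tendsto_of_le_of_le tendsto_const_nhds hsum
    (fun _ => zero_le) fun n => ?_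
  refine (measure_mono fun ω hω => ?_).trans (measure_biUnion_finset_le I _)
  by_contra hc
  simp only [Set.mem_iUnion, Set.mem_ofPred_eq, not_exists, not_not] at hc
  exact hω (htU fun i hi => hc i hi)

theorem tendstoInProb_of_tendsto {z : ℕ → α} {a : α} (h : Tendsto z atTop (𝓝 a)) :
    TendstoInProb P (fun n _ => z n) a := by
  intro U hU
  refine tendsto_const_nhds.congr' ?_
  filter_upwards [h hU] with n hn
  simp [show z n ∈ U from hn]

theorem tendstoInMeasure_const_iff {E : Type*} [PseudoMetricSpace E] {Z : ℕ → Ω → E} {z : E} :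
    TendstoInMeasure P Z atTop (fun _ => z) ↔ TendstoInProb P Z z := by
  rw [tendstoInMeasure_iff_dist]
  constructor
  · intro h U hU
    obtain ⟨r, hr, hrU⟩ := Metric.mem_nhds_iff.1 hU
    refine tendsto_of_tendsto_of_tendsto_of_le_of_le tendsto_const_nhds (h r hr)
      (fun _ => zero_le) fun n => measure_mono fun ω hω => ?_
    exact not_lt.1 fun hlt => hω (hrU (Metric.mem_ball.2 hlt))
  · intro h r hr
    refine (h _ (Metric.ball_mem_nhds z hr)).congr fun n => ?_
    simp

/-- Subadditivity gives `1 ≤ P (G n) + P {Z n ∉ W}`, so no measurability of the events is required.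
-/
theorem TendstoInProb.tendsto_measure_one [IsProbabilityMeasure P] {Z : ℕ → Ω → α} {z : α}
    (hZ : TendstoInProb P Z z) {W : Set α} (hW : W ∈ 𝓝 z) {G : ℕ → Set Ω}
    (hG : ∀ n ω, Z n ω ∈ W → ω ∈ G n) : Tendsto (fun n => P (G n)) atTop (𝓝 1) := by
  have h1 : Tendsto (fun n => 1 - P {ω | Z n ω ∉ W}) atTop (𝓝 1) := by
    simpa using ENNReal.Tendsto.sub (tendsto_const_nhds (x := (1 : ℝ≥0∞))) (hZ W hW)
      (Or.inl ENNReal.one_ne_top)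
  refine tendsto_of_tendsto_of_tendsto_of_le_of_le h1 tendsto_const_nhds (fun n => ?_)
    fun n => prob_le_one
  refine tsub_le_iff_right.2 ?_
  rw [← measure_univ (μ := P)]
  refine (measure_mono fun ω _ => ?_).trans (measure_union_le _ _)
  by_cases h : Z n ω ∈ W
  · exact Or.inl (hG n ω h)
  · exact Or.inr h

end InProbability

/-! ### Probability limits in the regression model -/

theorem MeanErgodic.tendstoInProb [IsProbabilityMeasure P] {u : ℤ → Ω → ℝ}
    (hu : MeanErgodic P u) :
    TendstoInProb P (fun n ω => (n : ℝ)⁻¹ * ∑ t : Fin n, u ((t : ℕ) + 1 : ℤ) ω)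
      (∫ ω, u 1 ω ∂P) := by
  have havg := fun n => integrable_average hu.integrable (n := n)
  have hsum : ∀ (n : ℕ) ω, ∑ t : Fin n, u ((t : ℕ) + 1 : ℤ) ω
      = ∑ j ∈ Finset.range n, u ((j : ℤ) + 1) ω :=
    fun n ω => Fin.sum_univ_eq_sum_range (fun j : ℕ => u ((j : ℤ) + 1) ω) n
  simp_rw [hsum]
  rw [← tendstoInMeasure_const_iff]
  refine tendstoInMeasure_of_tendsto_eLpNorm one_ne_zero (fun n => (havg n).aestronglyMeasurable)
    aestronglyMeasurable_const ?_
  have h := ENNReal.tendsto_ofReal hu.tendsto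
  rw [ENNReal.ofReal_zero] at h
  refine h.congr fun n => ?_
  rw [eLpNorm_one_eq_lintegral_enorm,
    ← ofReal_integral_norm_eq_lintegral_enorm ((havg n).sub (integrable_const _))]
  rfl

namespace IsRegressionModel

variable {p : ℕ} {β : Fin p → ℝ} {σsq : ℝ≥0} {x : ℤ → Ω → Fin p → ℝ} {y ε : ℤ → Ω → ℝ}
  (h : IsRegressionModel P β σsq x y ε)

include h

theorem memLp_x (i : Fin p) : MemLp (fun ω => x 1 ω i) 2 P := h.linear.memLp 1 (Sum.inl i)

theorem memLp_eps : MemLp (ε 1) 2 P := h.linear.memLp 1 (Sum.inr 1)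

theorem integrable_x_mul (i j : Fin p) : Integrable (fun ω => x 1 ω i * x 1 ω j) P :=
  (h.memLp_x i).integrable_mul (h.memLp_x j)

theorem integrable_x_mul_eps (i : Fin p) : Integrable (fun ω => x 1 ω i * ε 1 ω) P :=
  (h.memLp_x i).integrable_mul h.memLp_eps

theorem integral_x_mul_y (i : Fin p) :
    ∫ ω, x 1 ω i * y 1 ω ∂P = (regressorCov P x *ᵥ β) i := by
  have e : ∀ ω, x 1 ω i * y 1 ω = ∑ j, β j * (x 1 ω i * x 1 ω j) + x 1 ω i * ε 1 ω := fun ω => by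
    rw [h.equation, mul_add, Finset.mul_sum]
    congr 1
    exact Finset.sum_congr rfl fun j _ => by ring
  simp_rw [e]
  rw [integral_add (integrable_finsetSum _ fun j _ => (h.integrable_x_mul i j).const_mul _)
    (h.integrable_x_mul_eps i), h.uncorrelated, add_zero,
    integral_finsetSum _ fun j _ => (h.integrable_x_mul i j).const_mul _]
  simp_rw [integral_const_mul, Matrix.mulVec, dotProduct, regressorCov, Matrix.of_apply, mul_comm]

theorem integral_eps_sq : ∫ ω, ε 1 ω ^ 2 ∂P = σsq := by
  have hl := h.errors_law 1
  have h0 : ∫ ω, ε 1 ω ∂P = 0 := by rw [hl.integral_eq, integral_id_gaussianReal]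
  rw [← variance_of_integral_eq_zero hl.aemeasurable h0, hl.variance_eq, variance_id_gaussianReal]

theorem integral_y_mul_y :
    ∫ ω, y 1 ω * y 1 ω ∂P = β ⬝ᵥ (regressorCov P x *ᵥ β) + σsq := by
  have hy : MemLp (y 1) 2 P := h.linear.memLp 1 (Sum.inr 0)
  have hxy : ∀ i, Integrable (fun ω => x 1 ω i * y 1 ω) P :=
    fun i => (h.memLp_x i).integrable_mul hy
  -- Only one factor `y` is expanded in the regressors, so that the cross moments already computed
  -- can be reused.
  have e : ∀ ω, y 1 ω * y 1 ω = ∑ i, β i * (x 1 ω i * y 1 ω)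
      + (∑ i, β i * (x 1 ω i * ε 1 ω) + ε 1 ω ^ 2) := fun ω => by
    have e1 : ∀ f : ℝ, ∑ i, β i * (x 1 ω i * f) = (∑ i, β i * x 1 ω i) * f := fun f => by
      rw [Finset.sum_mul]
      exact Finset.sum_congr rfl fun i _ => by ring
    rw [e1, e1, h.equation]
    ring
  have i1 := integrable_finsetSum Finset.univ fun i _ => (hxy i).const_mul (β i)
  have i2 := integrable_finsetSum Finset.univ fun i _ => (h.integrable_x_mul_eps i).const_mul (β i)
  simp_rw [e]
  rw [integral_add i1 (by exact i2.add h.memLp_eps.integrable_sq),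
    integral_add i2 h.memLp_eps.integrable_sq, h.integral_eps_sq,
    integral_finsetSum _ fun i _ => (hxy i).const_mul (β i),
    integral_finsetSum _ fun i _ => (h.integrable_x_mul_eps i).const_mul (β i)]
  simp_rw [integral_const_mul, h.uncorrelated, h.integral_x_mul_y, dotProduct]
  simp

variable [IsProbabilityMeasure P]

theorem tendstoInProb_sampleMoment :
    TendstoInProb P (fun n ω => sampleMoment (sampleX x n ω)) (regressorCov P x) :=
  TendstoInProb.pi fun i => TendstoInProb.pi fun j =>
    (h.linear.meanErgodic_mul (Sum.inl i) (Sum.inl j)).tendstoInProb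

theorem tendstoInProb_sampleCross :
    TendstoInProb P (fun n ω => sampleCross (sampleX x n ω) (sampleY y n ω))
      (regressorCov P x *ᵥ β) :=
  TendstoInProb.pi fun i => by
    rw [← h.integral_x_mul_y]
    exact (h.linear.meanErgodic_mul (Sum.inl i) (Sum.inr 0)).tendstoInProb

theorem tendstoInProb_sampleSq :
    TendstoInProb P (fun n ω => (n : ℝ)⁻¹ * (sampleY y n ω ⬝ᵥ sampleY y n ω))
      (β ⬝ᵥ (regressorCov P x *ᵥ β) + σsq) := by
  rw [← h.integral_y_mul_y]
  exact (h.linear.meanErgodic_mul (Sum.inr 0) (Sum.inr 0)).tendstoInProb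

theorem tendstoInProb_sigmaHatSq (γ : Model p) :
    TendstoInProb P (fun n ω => sigmaHatSq (sampleX x n ω) (sampleY y n ω) γ)
      (limitRisk (regressorCov P x) β σsq γ) := by
  have hdet := isUnit_det_normalMatrix h.nonsingular γ
  have hZ := h.tendstoInProb_sampleMoment.prodMk
    (h.tendstoInProb_sampleCross.prodMk h.tendstoInProb_sampleSq)
  have hc : Continuous fun z : Matrix (Fin p) (Fin p) ℝ × (Fin p → ℝ) × ℝ =>
      (normalMatrix γ z.1).det := by
    unfold normalMatrix
    fun_prop
  -- The formula for the residual variance holds only where the sample normal matrix is invertible,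
  -- so the neighbourhood is cut down to nonzero determinant.
  refine hZ.map_of_eventually fun U hU => ⟨_, inter_mem (continuousAt_projRisk hdet hU)
    (hc.continuousAt.eventually_ne hdet.ne_zero), ?_⟩
  filter_upwards [eventually_ne_atTop 0] with n hn ω hω
  rw [sigmaHatSq_eq_projRisk hn _ _ _ (isUnit_iff_ne_zero.2 hω.2)]
  exact hω.1

/-- The limit risk is positive, so the logarithm is continuous there; the penalty is deterministic
of order `log n / n`. -/
theorem tendstoInProb_sampleBIC :
    TendstoInProb P (sampleBIC x y)
      (fun γ => Real.log (limitRisk (regressorCov P x) β σsq γ)) := by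
  refine TendstoInProb.pi fun γ => ?_
  have hpos := limitRisk_pos (β := β) h.nonsingular
    (show (0 : ℝ) < σsq from by exact_mod_cast h.sigma_pos) γ
  have hlog : Tendsto (fun n : ℕ => numReg γ * (Real.log n / n)) atTop (𝓝 0) := by
    have := (Real.isLittleO_log_id_atTop.tendsto_div_nhds_zero.comp
      tendsto_natCast_atTop_atTop).const_mul (numReg γ : ℝ)
    rw [mul_zero] at this
    exact this
  have hsum := ((h.tendstoInProb_sigmaHatSq γ).map (Real.continuousAt_log hpos.ne')).prodMk
    (tendstoInProb_of_tendsto (P := P) hlog)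
  have := hsum.map (f := fun z : ℝ × ℝ => z.1 + z.2) continuous_add.continuousAt
  rw [add_zero] at this
  exact this

end IsRegressionModel

end GSA

/-! ### Limits of the indices and the ranking -/

theorem mainTheorem1 {Ω : Type*} [MeasurableSpace Ω] (P : Measure Ω) [IsProbabilityMeasure P]
    {p : ℕ} (β : Fin p → ℝ) (σsq : ℝ≥0) (x : ℤ → Ω → Fin p → ℝ) (y ε : ℤ → Ω → ℝ)
    (hmodel : GSA.IsRegressionModel P β σsq x y ε)
    (hT : (GSA.trueSet β).Nonempty)
    (horth : ∀ j ∈ GSA.trueSet β, ∀ l ∉ GSA.trueSet β, GSA.regressorCov P x l j = 0) :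
    ∃ (c : Fin p → ℝ) (V : ℝ),
      -- `c i` is the probability limit of `σ²_{Ti}` and `V` that of the variance of `q`
      (∀ i, TendstoInMeasure P (fun n ω => GSA.totalEffectVar (GSA.sampleBIC x y n ω) i)
        atTop (fun _ => c i)) ∧
      TendstoInMeasure P (fun n ω => GSA.unifVar (GSA.sampleBIC x y n ω)) atTop (fun _ => V) ∧
      0 < V ∧
      (∀ i ∈ GSA.trueSet β, 0 < c i) ∧ (∀ i ∉ GSA.trueSet β, c i = 0) ∧
      -- the ordered total sensitivity indices converge to the ordered limits
      TendstoInMeasure P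
        (fun n ω => GSA.decreasing (GSA.totalSensitivity (GSA.sampleBIC x y n ω)))
        atTop (fun _ => GSA.decreasing (fun i => c i / V)) ∧
      -- the limit has positive entries in the first `r₀` positions and zeros afterwards
      (∀ k : Fin p, (k : ℕ) < (GSA.trueSet β).card → 0 < GSA.decreasing (fun i => c i / V) k) ∧
      (∀ k : Fin p, (GSA.trueSet β).card ≤ (k : ℕ) → GSA.decreasing (fun i => c i / V) k = 0) ∧
      -- with probability tending to one, every decreasing ordering of the regressors places
      -- exactly the true ones in the first `r₀` positions
      Tendsto (fun n => P {ω | ∀ π : Equiv.Perm (Fin p),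
          Antitone (fun k => GSA.totalSensitivity (GSA.sampleBIC x y n ω) (π k)) →
          ∀ k : Fin p, (k : ℕ) < (GSA.trueSet β).card ↔ π k ∈ GSA.trueSet β})
        atTop (𝓝 1) := by
  set q : GSA.Model p → ℝ := fun γ =>
    Real.log (GSA.limitRisk (GSA.regressorCov P x) β σsq γ) with hq
  have hσ : (0 : ℝ) < σsq := by exact_mod_cast hmodel.sigma_pos
  have hS := hmodel.nonsingular
  have hqlim := hmodel.tendstoInProb_sampleBIC
  -- The full model against the full model without `i`: one unequal pair makes both the total effect
  -- of `i` and the total variance positive.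
  have hqne : ∀ i ∈ GSA.trueSet β, q (GSA.combine i true fun _ => true)
      ≠ q (GSA.combine i false fun _ => true) := by
    intro i hi
    have hall : GSA.combine i true (fun _ => true) = fun _ => true := by
      funext k
      simp [GSA.combine]
    have hlt := GSA.lt_limitRisk (s := σsq) hS (γ := GSA.combine i false fun _ => true) (i := i)
      (by simp [GSA.combine]) (by simpa [GSA.trueSet] using hi)
    simp only [hq, hall, GSA.limitRisk_all hS]
    exact (Real.log_lt_log hσ hlt).ne
  have hV : 0 < GSA.unifVar q := by
    obtain ⟨i, hi⟩ := hT
    exact GSA.unifVar_pos (hqne i hi)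
  have hpos : ∀ i ∈ GSA.trueSet β, 0 < GSA.totalEffectVar q i :=
    fun i hi => GSA.totalEffectVar_pos _ (hqne i hi)
  have hzero : ∀ i ∉ GSA.trueSet β, GSA.totalEffectVar q i = 0 := fun i hi =>
    GSA.totalEffectVar_eq_zero fun b b' g => by
      simp only [hq, GSA.limitRisk_combine hS horth hi b b' g]
  have hSlim : GSA.TendstoInProb P (fun n ω => GSA.totalSensitivity (GSA.sampleBIC x y n ω))
      (fun i => GSA.totalEffectVar q i / GSA.unifVar q) :=
    hqlim.map (f := GSA.totalSensitivity) (continuousAt_pi.2 fun i =>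
      (GSA.continuous_totalEffectVar i).continuousAt.div GSA.continuous_unifVar.continuousAt hV.ne')
  obtain ⟨i₀, hi₀, hmin⟩ := Finset.exists_min_image _
    (fun i => GSA.totalEffectVar q i / GSA.unifVar q) hT
  have hr := div_pos (hpos i₀ hi₀) hV
  refine ⟨fun i => GSA.totalEffectVar q i, GSA.unifVar q, fun i => ?_, ?_, hV, hpos, hzero, ?_,
    fun k hk => GSA.decreasing_pos hr hmin hk, fun k hk => GSA.decreasing_eq_zero (T := GSA.trueSet β)
      (fun i => ?_) (fun i hi => ?_) hk, ?_⟩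
  · exact GSA.tendstoInMeasure_const_iff.2
      (hqlim.map (GSA.continuous_totalEffectVar i).continuousAt)
  · exact GSA.tendstoInMeasure_const_iff.2 (hqlim.map GSA.continuous_unifVar.continuousAt)
  · exact GSA.tendstoInMeasure_const_iff.2 (hSlim.map GSA.continuous_decreasing.continuousAt)
  · by_cases hi : i ∈ GSA.trueSet β
    · exact (div_pos (hpos i hi) hV).le
    · simp [hzero i hi]
  · simp [hzero i hi]
  · set r := GSA.totalEffectVar q i₀ / GSA.unifVar q
    -- `r` is the smallest limiting index of a true regressor, so level `r / 2` strictly separates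
    -- the true limits from the zeros, which persists in a neighbourhood.
    have hW : ∀ᶠ a : Fin p → ℝ in 𝓝 fun i => GSA.totalEffectVar q i / GSA.unifVar q,
        (∀ i ∈ GSA.trueSet β, r / 2 ≤ a i) ∧ ∀ i ∉ GSA.trueSet β, a i < r / 2 := by
      have hc : ∀ i, Tendsto (fun a : Fin p → ℝ => a i)
          (𝓝 fun i => GSA.totalEffectVar q i / GSA.unifVar q)
          (𝓝 (GSA.totalEffectVar q i / GSA.unifVar q)) := fun i => (continuous_apply i).tendsto _
      refine Eventually.and ?_ ?_ <;> refine eventually_all.2 fun i => ?_ <;>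
        by_cases hi : i ∈ GSA.trueSet β
      · filter_upwards [(hc i).eventually_const_le ((half_lt_self hr).trans_le (hmin i hi))]
          with a ha _ using ha
      · exact Eventually.of_forall fun _ h => absurd h hi
      · exact Eventually.of_forall fun _ h => absurd hi h
      · filter_upwards [(hc i).eventually_lt_const (by rw [hzero i hi, zero_div]; exact half_pos hr)]
          with a ha _ using ha
    exact hSlim.tendsto_measure_one hW fun n ω hω π hπ k =>
      GSA.mem_of_antitone_of_separated hω.1 hω.2 π hπ k
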